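/- Let $K$ be an algebraically closed field of characteristic zero, let $\Gamma$ be a cyclic group of prime order with dual group $\hat\Gamma=\mathrm{Hom}(\Gamma,K^\times)$, and let $G$ be an affine algebraic group over $K$ with Hopf algebra of regular functions $\mathcal O(G)$. Let $(i,\alpha)$ be an invariant cocentral action of $\Gamma$ on $G$, that is, an injective homomorphism $i\colon\hat\Gamma\to Z(G)$ into the centre of $G$ together with a homomorphism $\alpha\colon\Gamma\to\mathrm{Aut}(G)$ into the group of automorphisms of the algebraic group $G$ such that $\alpha_g(i(\psi))=i(\psi)$ for all $g\in\Gamma$, $\psi\in\hat\Gamma$. For $g\in\Gamma$ put $\mathcal O(G)_g=\{a\in\mathcal O(G) : a(i(\psi)x)=\psi(g)a(x)\ \text{for all } x\in G,\ \psi\in\hat\Gamma\}$, so that $\mathcal O(G)=\bigoplus_{g\in\Gamma}\mathcal O(G)_g$, and let $\Gamma$ act on $\mathcal O(G)$ by $\alpha_g(a)=a\circ\alpha_{g^{-1}}$. The graded twisting $\mathcal O(G^{t,\alpha})$ is the Hopf algebra $$\mathcal O(G^{t,\alpha})=\sum_{g\in\Gamma}\mathcal O(G)_g\otimes g\ \subset\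 \mathcal O(G)\rtimes\Gamma,$$ with the multiplication $(a\otimes g)(b\otimes h)=a\,\alpha_g(b)\otimes gh$ of the crossed product and with the coalgebra structure transported from $\mathcal O(G)$ along the linear isomorphism $\sum_g a_g\mapsto\sum_g a_g\otimes g$. A subgroup $H\subset G$ is called $\Gamma$-stable if $\alpha_g(H)\subset H$ for all $g\in\Gamma$; if $H$ is a $\Gamma$-stable algebraic (that is, Zariski closed) subgroup containing $i(\hat\Gamma)$, then $(i,\alpha)$ restricts to an invariant cocentral action of $\Gamma$ on $H$, which defines $\mathcal O(H^{t,\alpha})$. For such $H$ put $H_1=\{x\in H : \alpha_g(x)\in i(\hat\Gamma)x\ \text{for all } g\in\Gamma\}$. Let $L$ be a Hopf algebra quotient of $\mathcal O(G^{t,\alpha})$, that is, a Hopf algebra over $K$ with a surjective Hopf algebra homomorphism $\mathcal O(G^{t,\alpha})\to L$. Then (at least) one of the following assertions holds, where isomorphisms are isomorphisms of Hopf algebras: 1. $L$ is commutative and is isomorphic to $\mathcal O(H)$ for an algebraic subgroup $H\subset G/i(\hat\Gamma)$; 2. $L$ is commutative and is isomorphic to $\mathcal O(H^{t,\alpha})$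 for a $\Gamma$-stable algebraic subgroup $H\subset G$ such that $i(\hat\Gamma)\subset H$ and $H_1=H$; 3. $L$ is noncommutative and is isomorphic to $\mathcal O(H^{t,\alpha})$ for a $\Gamma$-stable algebraic subgroup $H\subset G$ such that $i(\hat\Gamma)\subset H$ and $H_1\neq H$. -/

import Mathlib

open scoped TensorProduct

set_option linter.unusedSectionVars false

/-- If functionals on `V` and on `W` separate points, then so do their products on `V ⊗ W`. -/
theorem TensorProduct.eq_zero_of_separating {K V W X Y : Type*} [Field K] [AddCommGroup V]
    [Module K V] [AddCommGroup W] [Module K W] (φ : X → V →ₗ[K] K) (ψ : Y → W →ₗ[K] K)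
    (hφ : ∀ v, (∀ x, φ x v = 0) → v = 0) (hψ : ∀ w, (∀ y, ψ y w = 0) → w = 0)
    (t : V ⊗[K] W) (ht : ∀ x y, LinearMap.mul' K K (TensorProduct.map (φ x) (ψ y) t) = 0) :
    t = 0 := by
  classical
  let b := Module.Basis.ofVectorSpace K W
  let e := TensorProduct.equivFinsuppOfBasisRight (M := V) b
  apply e.injective
  rw [map_zero]
  -- the partial evaluation
  have key : ∀ (x : X) (s : V ⊗[K] W) (k),
      b.repr (TensorProduct.lid K W ((φ x).rTensor W s)) k = φ x (e s k) := by
    intro x s k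
    induction s with
    | zero => simp
    | add s t hs ht => simp only [map_add, Finsupp.add_apply, hs, ht]
    | tmul v w => simp [e, mul_comm]
  have key2 : ∀ (x : X) (y : Y) (s : V ⊗[K] W),
      ψ y (TensorProduct.lid K W ((φ x).rTensor W s)) =
        LinearMap.mul' K K (TensorProduct.map (φ x) (ψ y) s) := by
    intro x y s
    induction s with
    | zero => simp
    | add s t hs ht => simp only [map_add, hs, ht]
    | tmul v w => simp
  ext k
  apply hφ
  intro x
  rw [← key, hψ (TensorProduct.lid K W ((φ x).rTensor W t)) fun y => by rw [key2, ht]]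
  simp

/-- An affine algebraic group over a field `K` (meant for algebraically closed `K`), in the classical
language of varieties: a group `G` with a finitely generated algebra of `K`-valued functions on it,
the regular functions, such that points of `G` are the same as characters of this algebra (so `G` is
an affine variety) and multiplication and inversion are morphisms of varieties, that is,
`f (x * y)` is a regular function on `G × G` and `f x⁻¹` is regular on `G` for every regular `f`. -/
class AffineAlgebraicGroup (K : Type*) (G : Type*) [Field K] [Group G] where
  regular : Subalgebra K (G → K)
  fg : regular.FG
  separates : ∀ x y : G, (∀ f ∈ regular, f x = f y) → x = y
  exists_point : ∀ χ : regular →ₐ[K] K, ∃ x : G, ∀ f : regular, χ f = f.1 x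
  regular_mul : ∀ f ∈ regular, ∃ (n : ℕ) (a b : Fin n → G → K),
    (∀ i, a i ∈ regular) ∧ (∀ i, b i ∈ regular) ∧ ∀ x y, f (x * y) = ∑ i, a i x * b i y
  regular_inv : ∀ f ∈ regular, (fun x => f x⁻¹) ∈ regular

/-- The algebra `𝒪(G)` of regular functions on `G`. -/
def CoordRing (K G : Type*) [Field K] [Group G] [AffineAlgebraicGroup K G] : Type _ :=
  ↥(AffineAlgebraicGroup.regular (K := K) (G := G))

namespace CoordRing
variable (K : Type*) {G : Type*} [Field K] [Group G] [AffineAlgebraicGroup K G]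

noncomputable instance : CommRing (CoordRing K G) :=
  inferInstanceAs (CommRing ↥(AffineAlgebraicGroup.regular (K := K) (G := G)))

noncomputable instance : Algebra K (CoordRing K G) :=
  inferInstanceAs (Algebra K ↥(AffineAlgebraicGroup.regular (K := K) (G := G)))

instance : FunLike (CoordRing K G) G K where
  coe f := f.1
  coe_injective _ _ h := Subtype.ext h

/-- A regular function, regarded as an element of `𝒪(G)`. -/
def mk (f : G → K) (hf : f ∈ AffineAlgebraicGroup.regular (K := K) (G := G)) : CoordRing K G :=
  ⟨f, hf⟩

@[simp] theorem mk_apply (f : G → K) (hf) (x : G) : mk K f hf x = f x := rfl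

theorem mem_regular (f : CoordRing K G) :
    (f : G → K) ∈ AffineAlgebraicGroup.regular (K := K) (G := G) := f.2

/-- Evaluation at a point. -/
noncomputable def eval (x : G) : CoordRing K G →ₐ[K] K :=
  (Pi.evalAlgHom K (fun _ : G => K) x).comp
    (Subalgebra.val (AffineAlgebraicGroup.regular (K := K) (G := G)))

@[simp] theorem eval_apply (x : G) (f : CoordRing K G) : eval K x f = f x := rfl

variable {K} in
@[simp] theorem add_apply (f g : CoordRing K G) (x : G) : (f + g) x = f x + g x := rfl
variable {K} in
@[simp] theorem mul_apply (f g : CoordRing K G) (x : G) : (f * g) x = f x * g x := rfl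
variable {K} in
@[simp] theorem smul_apply (r : K) (f : CoordRing K G) (x : G) : (r • f) x = r * f x := rfl
@[simp] theorem zero_apply (x : G) : (0 : CoordRing K G) x = 0 := rfl
@[simp] theorem one_apply (x : G) : (1 : CoordRing K G) x = 1 := rfl
variable {K} in
@[simp] theorem sub_apply (f g : CoordRing K G) (x : G) : (f - g) x = f x - g x := rfl
variable {K} in
@[simp] theorem algebraMap_apply (r : K) (x : G) : algebraMap K (CoordRing K G) r x = r := rfl
variable {K} in
@[simp] theorem sum_apply {ι : Type*} (s : Finset ι) (f : ι → CoordRing K G) (x : G) :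
    (∑ i ∈ s, f i) x = ∑ i ∈ s, f i x := map_sum (eval K x) f s

/-- Evaluation of `f ⊗ g` at a pair of points, `f x * g y`. -/
noncomputable def eval₂ (x y : G) : CoordRing K G ⊗[K] CoordRing K G →ₐ[K] K :=
  Algebra.TensorProduct.lift (eval K x) (eval K y) fun _ _ => Commute.all _ _

@[simp] theorem eval₂_tmul (x y : G) (f g : CoordRing K G) :
    eval₂ K x y (f ⊗ₜ g) = f x * g y := rfl

variable {K}

theorem ext_eval {s t : CoordRing K G} (h : ∀ x : G, eval K x s = eval K x t) : s = t :=
  DFunLike.ext _ _ h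

theorem ext_eval₂ {s t : CoordRing K G ⊗[K] CoordRing K G}
    (h : ∀ x y : G, eval₂ K x y s = eval₂ K x y t) : s = t := by
  rw [← sub_eq_zero]
  refine TensorProduct.eq_zero_of_separating (fun x : G => (eval K x).toLinearMap)
    (fun y : G => (eval K y).toLinearMap) (fun v hv => ext_eval fun x => by simpa using hv x)
    (fun v hv => ext_eval fun x => by simpa using hv x) _ fun x y => ?_
  have : ∀ u : CoordRing K G ⊗[K] CoordRing K G,
      LinearMap.mul' K K (TensorProduct.map (eval K x).toLinearMap (eval K y).toLinearMap u) =
        eval₂ K x y u := by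
    intro u
    induction u with
    | zero => simp
    | add s t hs ht => simp only [map_add, hs, ht]
    | tmul v w => simp
  rw [this, map_sub, h, sub_self]

/-- Evaluation at a triple of points. -/
noncomputable def eval₃ (x y z : G) : CoordRing K G ⊗[K] (CoordRing K G ⊗[K] CoordRing K G) →ₐ[K] K :=
  Algebra.TensorProduct.lift (eval K x) (eval₂ K y z) fun _ _ => Commute.all _ _

@[simp] theorem eval₃_tmul (x y z : G) (f : CoordRing K G) (g : CoordRing K G ⊗[K] CoordRing K G) :
    eval₃ x y z (f ⊗ₜ g) = f x * eval₂ K y z g := rfl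

theorem ext_eval₃ {s t : CoordRing K G ⊗[K] (CoordRing K G ⊗[K] CoordRing K G)}
    (h : ∀ x y z : G, eval₃ x y z s = eval₃ x y z t) : s = t := by
  rw [← sub_eq_zero]
  refine TensorProduct.eq_zero_of_separating (fun x : G => (eval K x).toLinearMap)
    (fun y : G × G => (eval₂ K y.1 y.2).toLinearMap)
    (fun v hv => ext_eval fun x => by simpa using hv x)
    (fun v hv => ext_eval₂ fun x y => by simpa using hv (x, y)) _ fun x y => ?_
  have : ∀ u : CoordRing K G ⊗[K] (CoordRing K G ⊗[K] CoordRing K G),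
      LinearMap.mul' K K
        (TensorProduct.map (eval K x).toLinearMap (eval₂ K y.1 y.2).toLinearMap u) =
        eval₃ x y.1 y.2 u := by
    intro u
    induction u with
    | zero => simp
    | add s t hs ht => simp only [map_add, hs, ht]
    | tmul v w => simp
  rw [this, map_sub, h, sub_self]

theorem exists_comul (f : CoordRing K G) :
    ∃ t : CoordRing K G ⊗[K] CoordRing K G, ∀ x y : G, eval₂ K x y t = f (x * y) := by
  obtain ⟨n, a, b, ha, hb, h⟩ := AffineAlgebraicGroup.regular_mul f.1 f.2
  exact ⟨∑ i, mk K (a i) (ha i) ⊗ₜ mk K (b i) (hb i), fun x y => by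
    rw [map_sum]; exact (h x y).symm⟩

/-- The comultiplication of `𝒪(G)`: the element with `Δ(f)(x, y) = f (x * y)`. -/
noncomputable def comulFun (f : CoordRing K G) : CoordRing K G ⊗[K] CoordRing K G :=
  (exists_comul f).choose

@[simp] theorem eval₂_comulFun (f : CoordRing K G) (x y : G) :
    eval₂ K x y (comulFun f) = f (x * y) := (exists_comul f).choose_spec x y

/-- The comultiplication as an algebra homomorphism. -/
noncomputable def comulHom : CoordRing K G →ₐ[K] CoordRing K G ⊗[K] CoordRing K G where
  toFun := comulFun
  map_one' := ext_eval₂ fun x y => by simp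
  map_mul' f g := ext_eval₂ fun x y => by simp
  map_zero' := ext_eval₂ fun x y => by simp
  map_add' f g := ext_eval₂ fun x y => by simp
  commutes' r := ext_eval₂ fun x y => by rw [AlgHom.commutes]; simp

@[simp] theorem eval₂_comulHom (f : CoordRing K G) (x y : G) :
    eval₂ K x y (comulHom f) = f (x * y) := eval₂_comulFun f x y

/-- The antipode of `𝒪(G)`, `f ↦ (x ↦ f x⁻¹)`. -/
noncomputable def antipodeHom : CoordRing K G →ₐ[K] CoordRing K G where
  toFun f := mk K (fun x => f x⁻¹) (AffineAlgebraicGroup.regular_inv f.1 f.2)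
  map_one' := rfl
  map_mul' _ _ := rfl
  map_zero' := rfl
  map_add' _ _ := rfl
  commutes' _ := rfl

@[simp] theorem antipodeHom_apply (f : CoordRing K G) (x : G) :
    antipodeHom f x = f x⁻¹ := rfl

theorem eval₃_assoc_rTensor (x y z : G) (t : CoordRing K G ⊗[K] CoordRing K G) :
    eval₃ x y z (TensorProduct.assoc K _ _ _ (comulHom.toLinearMap.rTensor _ t)) =
      eval₂ K (x * y) z t := by
  induction t with
  | zero => simp
  | add s t hs ht => simp only [map_add, hs, ht]
  | tmul v w =>
    have : ∀ (u : CoordRing K G ⊗[K] CoordRing K G),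
        eval₃ x y z (TensorProduct.assoc K _ _ _ (u ⊗ₜ w)) = eval₂ K x y u * w z := by
      intro u
      induction u with
      | zero => simp
      | add s t hs ht => simp only [map_add, TensorProduct.add_tmul, hs, ht, add_mul]
      | tmul a b => simp [mul_assoc]
    simp [this]

theorem eval₃_lTensor (x y z : G) (t : CoordRing K G ⊗[K] CoordRing K G) :
    eval₃ x y z (comulHom.toLinearMap.lTensor _ t) = eval₂ K x (y * z) t := by
  induction t with
  | zero => simp
  | add s t hs ht => simp only [map_add, hs, ht]
  | tmul v w => simp

/-- `Δ(f)(x, y) = f (x * y)` and `ε(f) = f 1`. -/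
noncomputable instance : Coalgebra K (CoordRing K G) where
  comul := comulHom.toLinearMap
  counit := (eval K 1).toLinearMap
  coassoc := LinearMap.ext fun f => ext_eval₃ fun x y z => by
    have h1 := eval₃_assoc_rTensor x y z (comulHom f)
    have h2 := eval₃_lTensor x y z (comulHom f)
    simp only [eval₂_comulHom] at h1 h2
    simp only [LinearMap.comp_apply, LinearEquiv.coe_coe, AlgHom.toLinearMap_apply] at h1 h2 ⊢
    rw [h1, h2, mul_assoc]
  rTensor_counit_comp_comul := LinearMap.ext fun f => by
    apply (TensorProduct.lid K _).injective
    refine ext_eval fun y => ?_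
    have : ∀ t : CoordRing K G ⊗[K] CoordRing K G,
        (TensorProduct.lid K _ ((eval K 1).toLinearMap.rTensor _ t)) y = eval₂ K 1 y t := by
      intro t
      induction t with
      | zero => simp
      | add s t hs ht =>
        simp only [map_add, add_apply, hs, ht]
      | tmul v w => simp
    simpa using this (comulHom f)
  lTensor_counit_comp_comul := LinearMap.ext fun f => by
    apply (TensorProduct.rid K _).injective
    refine ext_eval fun y => ?_
    have : ∀ t : CoordRing K G ⊗[K] CoordRing K G,
        (TensorProduct.rid K _ ((eval K 1).toLinearMap.lTensor _ t)) y = eval₂ K y 1 t := by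
      intro t
      induction t with
      | zero => simp
      | add s t hs ht =>
        simp only [map_add, add_apply, hs, ht]
      | tmul v w => simp [mul_comm]
    simpa using this (comulHom f)

noncomputable instance : Bialgebra K (CoordRing K G) :=
  Bialgebra.mk' K _ (map_one (eval K (1 : G))) (fun {a b} => map_mul (eval K (1 : G)) a b)
    (map_one comulHom) (fun {a b} => map_mul comulHom a b)

noncomputable instance : HopfAlgebra K (CoordRing K G) where
  antipode := antipodeHom.toLinearMap
  mul_antipode_rTensor_comul := LinearMap.ext fun f => ext_eval fun x => by
    have : ∀ t : CoordRing K G ⊗[K] CoordRing K G,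
        (LinearMap.mul' K _ (antipodeHom.toLinearMap.rTensor _ t)) x = eval₂ K x⁻¹ x t := by
      intro t
      induction t with
      | zero => simp
      | add s t hs ht =>
        simp only [map_add, add_apply, hs, ht]
      | tmul v w => simp
    exact (this (comulHom f)).trans (by simp; rfl)
  mul_antipode_lTensor_comul := LinearMap.ext fun f => ext_eval fun x => by
    have : ∀ t : CoordRing K G ⊗[K] CoordRing K G,
        (LinearMap.mul' K _ (antipodeHom.toLinearMap.lTensor _ t)) x = eval₂ K x x⁻¹ t := by
      intro t
      induction t with
      | zero => simp
      | add s t hs ht =>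
        simp only [map_add, add_apply, hs, ht]
      | tmul v w => simp
    exact (this (comulHom f)).trans (by simp; rfl)

end CoordRing

/-! ### Algebraic subgroups -/

/-- Zariski closed subsets: common zero sets of regular functions. -/
def IsZariskiClosed (K : Type*) {G : Type*} [Field K] [Group G] [AffineAlgebraicGroup K G]
    (S : Set G) : Prop :=
  ∃ I : Set (CoordRing K G), S = {x | ∀ f ∈ I, f x = 0}

/-- An algebraic subgroup: a Zariski closed subgroup. -/
structure AlgebraicSubgroup (K G : Type*) [Field K] [Group G] [AffineAlgebraicGroup K G] extends
    Subgroup G where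
  isZariskiClosed : IsZariskiClosed K carrier

namespace AlgebraicSubgroup
variable {K G : Type*} [Field K] [Group G] [AffineAlgebraicGroup K G]

/-- Restriction of functions to a subgroup. -/
def restrictFun (K : Type*) {G : Type*} [Field K] [Group G] (H : Subgroup G) :
    (G → K) →ₐ[K] (H → K) where
  toFun f x := f x
  map_one' := rfl
  map_mul' _ _ := rfl
  map_zero' := rfl
  map_add' _ _ := rfl
  commutes' _ := rfl

/-- An algebraic subgroup is an affine algebraic group, with regular functions the restrictions of
the regular functions on `G`. -/
noncomputable instance (H : AlgebraicSubgroup K G) : AffineAlgebraicGroup K H.toSubgroup where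
  regular := (AffineAlgebraicGroup.regular (K := K) (G := G)).map (restrictFun K H.toSubgroup)
  fg := AffineAlgebraicGroup.fg.map _
  separates x y h := Subtype.ext <| AffineAlgebraicGroup.separates (K := K) x.1 y.1 fun f hf =>
    h _ ⟨f, hf, rfl⟩
  exists_point χ := by
    let r : AffineAlgebraicGroup.regular (K := K) (G := G) →ₐ[K]
        (AffineAlgebraicGroup.regular (K := K) (G := G)).map (restrictFun K H.toSubgroup) :=
      ((restrictFun K H.toSubgroup).comp (Subalgebra.val _)).codRestrict _
        fun f => ⟨f.1, f.2, rfl⟩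
    obtain ⟨x, hx⟩ := AffineAlgebraicGroup.exists_point (χ.comp r)
    have hxH : x ∈ H.toSubgroup := by
      obtain ⟨I, hI⟩ := H.isZariskiClosed
      change x ∈ H.carrier
      rw [hI]
      intro f hf
      change f.1 x = 0
      rw [← hx ⟨f.1, f.2⟩]
      have : r ⟨f.1, f.2⟩ = 0 := by
        refine Subtype.ext (funext fun y => ?_)
        have hy : y.1 ∈ H.carrier := y.2
        rw [hI] at hy
        exact hy f hf
      rw [AlgHom.comp_apply, this, map_zero]
    refine ⟨⟨x, hxH⟩, ?_⟩
    rintro ⟨_, f, hf, rfl⟩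
    exact hx ⟨f, hf⟩
  regular_mul := by
    rintro _ ⟨f, hf, rfl⟩
    obtain ⟨n, a, b, ha, hb, h⟩ := AffineAlgebraicGroup.regular_mul f hf
    exact ⟨n, fun i => restrictFun K H.toSubgroup (a i), fun i => restrictFun K H.toSubgroup (b i),
      fun i => ⟨_, ha i, rfl⟩, fun i => ⟨_, hb i, rfl⟩, fun x y => h x.1 y.1⟩
  regular_inv := by
    rintro _ ⟨f, hf, rfl⟩
    exact ⟨_, AffineAlgebraicGroup.regular_inv f hf, rfl⟩

end AlgebraicSubgroup

namespace AffineAlgebraicGroup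
variable {K G : Type*} [Field K] [Group G] [AffineAlgebraicGroup K G]

theorem regular_mul_left (f : G → K) (hf : f ∈ regular (K := K) (G := G)) (y : G) :
    (fun x => f (y * x)) ∈ regular (K := K) (G := G) := by
  obtain ⟨n, a, b, ha, hb, h⟩ := regular_mul f hf
  have : (fun x => f (y * x)) = ∑ i, a i y • b i := by
    funext x; simp [h]
  rw [this]
  exact Subalgebra.sum_mem _ fun i _ => Subalgebra.smul_mem _ (hb i) _

/-- Pullback of functions along `G → G ⧸ N`. -/
def pullbackFun (K : Type*) {G : Type*} [Field K] [Group G] (N : Subgroup G) :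
    (G ⧸ N → K) →ₐ[K] (G → K) where
  toFun f x := f x
  map_one' := rfl
  map_mul' _ _ := rfl
  map_zero' := rfl
  map_add' _ _ := rfl
  commutes' _ := rfl

variable (K) in
/-- The functions on `G ⧸ N` whose pullback to `G` is regular. -/
def quotientRegular (N : Subgroup G) : Subalgebra K (G ⧸ N → K) :=
  (regular (K := K) (G := G)).comap (pullbackFun K N)

variable (N : Subgroup G) [N.Normal]

theorem eq_mk_mul (n : N) (x : G) : ((n.1 * x : G) : G ⧸ N) = x := by
  rw [QuotientGroup.mk_mul, (QuotientGroup.eq_one_iff n.1).2 n.2, one_mul]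

/-- A function that is invariant under left translation by `N` descends to `G ⧸ N`. -/
theorem exists_descend (f : G → K) (hf : f ∈ regular (K := K) (G := G))
    (h : ∀ (n : N) x, f (n.1 * x) = f x) :
    ∃ F ∈ quotientRegular K N, ∀ x : G, F x = f x := by
  let F : G ⧸ N → K := Quotient.lift f fun a b hab => by
    have hab' : a⁻¹ * b ∈ N := QuotientGroup.leftRel_apply.1 hab
    have h2 := h ⟨a * (a⁻¹ * b) * a⁻¹, Subgroup.Normal.conj_mem inferInstance _ hab' a⟩ a
    simp only [mul_inv_cancel_left, inv_mul_cancel_right] at h2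
    exact h2.symm
  exact ⟨F, hf, fun x => rfl⟩

theorem quotient_inv (f : G ⧸ N → K) (hf : f ∈ quotientRegular K N) :
    (fun x => f x⁻¹) ∈ quotientRegular K N :=
  regular_inv (G := G) (fun x => f x) hf

variable [Finite N]

theorem quotient_separates (x y : G ⧸ N) (h : ∀ f ∈ quotientRegular K N, f x = f y) : x = y := by
  classical
  have := Fintype.ofFinite N
  induction x using QuotientGroup.induction_on with | _ x => ?_
  induction y using QuotientGroup.induction_on with | _ y => ?_
  by_contra hxy
  have hne : ∀ m : N, m.1 * x ≠ y := fun m hm => hxy (by rw [← hm, eq_mk_mul])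
  have hu : ∀ m : N, ∃ u ∈ regular (K := K) (G := G), u y = 1 ∧ u (m.1 * x) = 0 := by
    intro m
    by_contra hcon
    refine hne m (separates (K := K) _ _ fun f hf => ?_)
    by_contra hfne
    have hd : f y - f (m.1 * x) ≠ 0 := sub_ne_zero.2 fun h => hfne h.symm
    refine hcon ⟨(f y - f (m.1 * x))⁻¹ • (f - algebraMap K (G → K) (f (m.1 * x))),
      Subalgebra.smul_mem _ (Subalgebra.sub_mem _ hf (Subalgebra.algebraMap_mem _ _)) _, ?_, ?_⟩
    · simp [hd]
    · simp
  choose u hu1 hu2 hu3 using hu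
  let F : G → K := ∏ m, u m
  have hF : F ∈ regular (K := K) (G := G) := Subalgebra.prod_mem _ fun m _ => hu1 m
  have hFy : F y = 1 := by simp [F, hu2]
  have hFx : ∀ m : N, F (m.1 * x) = 0 := fun m => by
    simp only [F, Finset.prod_apply]
    exact Finset.prod_eq_zero (Finset.mem_univ m) (hu3 m)
  let P : G → K := ∏ n : N, fun z => 1 - F (n.1 * z)
  have hP : P ∈ regular (K := K) (G := G) := Subalgebra.prod_mem _ fun n _ =>
    Subalgebra.sub_mem _ (Subalgebra.one_mem _) (regular_mul_left F hF n.1)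
  have hPinv : ∀ (n : N) z, P (n.1 * z) = P z := by
    intro n z
    simp only [P, Finset.prod_apply]
    exact Fintype.prod_equiv (Equiv.mulRight n) _ _ fun m => by simp [mul_assoc]
  obtain ⟨Q, hQ, hQP⟩ := exists_descend N P hP hPinv
  have h1 := h Q hQ
  rw [hQP, hQP] at h1
  have hx1 : P x = 1 := by simp [P, hFx]
  have hy0 : P y = 0 := by
    simp only [P, Finset.prod_apply]
    exact Finset.prod_eq_zero (Finset.mem_univ 1) (by simp [hFy])
  rw [hx1, hy0] at h1
  exact one_ne_zero h1

theorem quotient_mul [CharZero K] (f : G ⧸ N → K) (hf : f ∈ quotientRegular K N) :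
    ∃ (n : ℕ) (a b : Fin n → G ⧸ N → K), (∀ i, a i ∈ quotientRegular K N) ∧
      (∀ i, b i ∈ quotientRegular K N) ∧ ∀ x y, f (x * y) = ∑ i, a i x * b i y := by
  have := Fintype.ofFinite N
  obtain ⟨k, a, b, ha, hb, h⟩ := regular_mul (G := G) (fun x => f x) hf
  have hc : (Fintype.card N : K) ≠ 0 := Nat.cast_ne_zero.2 Fintype.card_ne_zero
  -- averages over `N`
  have av : ∀ a : G → K, a ∈ regular (K := K) (G := G) → ∃ F ∈ quotientRegular K N,
      ∀ x : G, F x = (Fintype.card N : K)⁻¹ * ∑ n : N, a (n.1 * x) := by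
    intro a ha
    have : (fun x => (Fintype.card N : K)⁻¹ * ∑ n : N, a (n.1 * x)) =
        (Fintype.card N : K)⁻¹ • ∑ n : N, fun x => a (n.1 * x) := by
      funext x; simp
    refine exists_descend N (fun x => (Fintype.card N : K)⁻¹ * ∑ n : N, a (n.1 * x)) ?_ ?_
    · rw [this]
      exact Subalgebra.smul_mem _ (Subalgebra.sum_mem _ fun n _ => regular_mul_left a ha n.1) _
    · intro n x
      congr 1
      exact Fintype.sum_equiv (Equiv.mulRight n) _ _ fun m => by simp [mul_assoc]
  choose A hA hA' using fun i => av (a i) (ha i)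
  choose B hB hB' using fun i => av (b i) (hb i)
  refine ⟨k, A, B, hA, hB, fun x y => ?_⟩
  induction x using QuotientGroup.induction_on with | _ x => ?_
  induction y using QuotientGroup.induction_on with | _ y => ?_
  have h1 : ∀ n m : N, f ((x : G ⧸ N) * y) = ∑ i, a i (n.1 * x) * b i (m.1 * y) := by
    intro n m
    rw [← h, QuotientGroup.mk_mul, eq_mk_mul, eq_mk_mul]
  have h2 : (Fintype.card N : K) * (Fintype.card N : K) * f ((x : G ⧸ N) * y) =
      ∑ n : N, ∑ m : N, ∑ i, a i (n.1 * x) * b i (m.1 * y) := by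
    simp only [← h1, Finset.sum_const, Finset.card_univ, nsmul_eq_mul, mul_assoc]
  have h3 : ∑ n : N, ∑ m : N, ∑ i, a i (n.1 * x) * b i (m.1 * y) =
      ∑ i, (∑ n : N, a i (n.1 * x)) * ∑ m : N, b i (m.1 * y) := by
    simp only [Finset.sum_mul_sum]
    rw [Finset.sum_comm' (s := Finset.univ) (t := fun _ => Finset.univ) (t' := Finset.univ)
      (s' := fun _ => Finset.univ) (by simp)]
    rw [Finset.sum_comm]
    simp only [Finset.sum_comm (s := (Finset.univ : Finset (Fin k)))]
  calc f ((x : G ⧸ N) * y) = (Fintype.card N : K)⁻¹ * (Fintype.card N : K)⁻¹ *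
        ∑ i, (∑ n : N, a i (n.1 * x)) * ∑ m : N, b i (m.1 * y) := by
        rw [← h3, ← h2]; field_simp
    _ = ∑ i, A i x * B i y := by
        rw [Finset.mul_sum]
        refine Finset.sum_congr rfl fun i _ => ?_
        rw [hA', hB']; ring

theorem quotient_fg_point [IsAlgClosed K] :
    (quotientRegular K N).FG ∧ ∀ χ : quotientRegular K N →ₐ[K] K,
      ∃ x : G ⧸ N, ∀ f : quotientRegular K N, χ f = f.1 x := by
  have := Fintype.ofFinite N
  let R := regular (K := K) (G := G)
  let φ : quotientRegular K N →ₐ[K] R :=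
    ((pullbackFun K N).comp (Subalgebra.val _)).codRestrict R fun f => f.2
  have hφ : Function.Injective φ := by
    intro f g hfg
    refine Subtype.ext (funext fun x => ?_)
    induction x using QuotientGroup.induction_on with | _ x => ?_
    exact congrFun (congrArg Subtype.val hfg) x
  let _ : Algebra (quotientRegular K N) R := φ.toRingHom.toAlgebra
  have : IsScalarTower K (quotientRegular K N) R := IsScalarTower.of_algebraMap_eq fun r => rfl
  let ρ : N → R →+* R := fun n =>
    { toFun := fun f => ⟨fun x => f.1 (n.1⁻¹ * x), regular_mul_left f.1 f.2 _⟩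
      map_one' := rfl
      map_mul' := fun _ _ => rfl
      map_zero' := rfl
      map_add' := fun _ _ => rfl }
  let _ : MulSemiringAction N R :=
    { smul := fun n f => ρ n f
      one_smul := fun f => Subtype.ext (funext fun x => by
        change f.1 ((1 : N).1⁻¹ * x) = f.1 x; simp)
      mul_smul := fun n m f => Subtype.ext (funext fun x => by
        change f.1 ((n * m : N).1⁻¹ * x) = f.1 (m.1⁻¹ * (n.1⁻¹ * x)); simp [mul_assoc])
      smul_zero := fun n => map_zero (ρ n)
      smul_add := fun n => map_add (ρ n)
      smul_one := fun n => map_one (ρ n)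
      smul_mul := fun n => map_mul (ρ n) }
  have : Algebra.IsInvariant (quotientRegular K N) R N := ⟨fun f hf => by
    obtain ⟨F, hF, hFf⟩ := exists_descend N f.1 f.2 fun n x => by
      have := congrFun (congrArg Subtype.val (hf n⁻¹)) x
      change f.1 ((n⁻¹ : N).1⁻¹ * x) = f.1 x at this
      simpa using this
    exact ⟨⟨F, hF⟩, Subtype.ext (funext hFf)⟩⟩
  have hfaith : FaithfulSMul (quotientRegular K N) R :=
    (faithfulSMul_iff_algebraMap_injective _ _).2 hφ
  have hint : Algebra.IsIntegral (quotientRegular K N) R := Algebra.IsInvariant.isIntegral _ _ N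
  have hR : (⊤ : Subalgebra K R).FG := R.fg_top.2 fg
  have : Algebra.FiniteType K R := ⟨hR⟩
  have : Algebra.FiniteType (quotientRegular K N) R := Algebra.FiniteType.of_restrictScalars_finiteType K _ _
  have : Module.Finite (quotientRegular K N) R := Algebra.IsIntegral.finite
  refine ⟨?_, fun χ => ?_⟩
  · rw [← Subalgebra.fg_top]
    exact fg_of_fg_of_fg K (quotientRegular K N) R hR Module.Finite.fg_top hφ
  · have hmax : (RingHom.ker χ).IsMaximal :=
      RingHom.ker_isMaximal_of_surjective χ fun r => ⟨algebraMap K _ r, χ.commutes r⟩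
    obtain ⟨Q, -, hQ, hQχ⟩ := Ideal.exists_ideal_over_prime_of_isIntegral (RingHom.ker χ)
      (⊥ : Ideal R) (by
        intro f hf
        have : f = 0 := hφ (Eq.trans (b := 0) hf (map_zero φ).symm)
        rw [this]; exact zero_mem _)
    have := hQ
    -- `R ⧸ Q` is integral over `K`
    have hK : Algebra.IsIntegral K (R ⧸ Q) := ⟨fun z => by
      obtain ⟨f, rfl⟩ := Ideal.Quotient.mk_surjective z
      obtain ⟨p, hp, hpf⟩ := hint.isIntegral f
      refine ⟨p.map χ.toRingHom, hp.map _, ?_⟩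
      have hcomp : (algebraMap K (R ⧸ Q)).comp χ.toRingHom =
          (Ideal.Quotient.mk Q).comp (algebraMap (quotientRegular K N) R) := by
        ext g
        change algebraMap K (R ⧸ Q) (χ g) = Ideal.Quotient.mk Q (φ g)
        have hm : g - algebraMap K _ (χ g) ∈ RingHom.ker χ := by
          rw [RingHom.mem_ker, map_sub, AlgHom.commutes]; simp
        rw [← hQχ] at hm
        have h2 : Ideal.Quotient.mk Q (φ (g - algebraMap K _ (χ g))) = 0 :=
          Ideal.Quotient.eq_zero_iff_mem.2 hm
        rw [map_sub, map_sub, sub_eq_zero, AlgHom.commutes] at h2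
        rw [h2]; rfl
      rw [Polynomial.eval₂_map, hcomp, ← Polynomial.hom_eval₂, hpf, map_zero]⟩
    have hbij := IsAlgClosed.algebraMap_bijective_of_isIntegral (k := K) (K := R ⧸ Q)
    let e : K ≃ₐ[K] (R ⧸ Q) := AlgEquiv.ofBijective (Algebra.ofId K (R ⧸ Q)) hbij
    obtain ⟨x, hx⟩ := exists_point (K := K) (G := G)
      (e.symm.toAlgHom.comp (Ideal.Quotient.mkₐ K Q))
    refine ⟨x, fun f => ?_⟩
    have hm : f - algebraMap K _ (χ f) ∈ RingHom.ker χ := by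
      rw [RingHom.mem_ker, map_sub, AlgHom.commutes]; simp
    rw [← hQχ] at hm
    have h2 : Ideal.Quotient.mkₐ K Q (φ (f - algebraMap K _ (χ f))) = 0 :=
      Ideal.Quotient.eq_zero_iff_mem.2 hm
    have h3 := hx (φ (f - algebraMap K _ (χ f)))
    rw [AlgHom.comp_apply, h2, map_zero] at h3
    have h4 : (0 : K) = f.1 x - χ f := h3
    exact (sub_eq_zero.1 h4.symm).symm

/-- The quotient `G ⧸ N` by a finite normal subgroup is an affine algebraic group, with
`𝒪(G ⧸ N)` the functions on `G ⧸ N` whose pullback to `G` is regular. -/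
noncomputable instance [IsAlgClosed K] [CharZero K] : AffineAlgebraicGroup K (G ⧸ N) where
  regular := quotientRegular K N
  fg := (quotient_fg_point N).1
  separates := quotient_separates N
  exists_point := (quotient_fg_point N).2
  regular_mul := quotient_mul N
  regular_inv := quotient_inv N

end AffineAlgebraicGroup

/-! ### Graded twisting of Hopf algebras -/

/-- An invariant cocentral action of `Γ` on a Hopf algebra `A`: a decomposition `A = ⨁ A_g` with
`A_g A_h ⊆ A_{gh}` and `Δ(A_g) ⊆ A_g ⊗ A_g` (equivalently, a cocentral Hopf algebra homomorphism
`A → KΓ`), together with an action of `Γ` on `A` by Hopf algebra automorphisms that preserve every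
`A_h`. The fields `one_mem` and `antipode_mem` follow from the others and are
recorded for convenience. -/
structure InvariantCocentralAction (K Γ A : Type*) [Field K] [Group Γ] [Ring A] [HopfAlgebra K A] where
  component : Γ → Submodule K A
  iSupIndep_component : iSupIndep component
  iSup_component : ⨆ g, component g = ⊤
  one_mem : (1 : A) ∈ component 1
  mul_mem : ∀ g h, ∀ a ∈ component g, ∀ b ∈ component h, a * b ∈ component (g * h)
  comul_mem : ∀ g, ∀ a ∈ component g, Coalgebra.comul (R := K) a ∈
    LinearMap.range (TensorProduct.map (component g).subtype (component g).subtype)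
  antipode_mem : ∀ g, ∀ a ∈ component g, HopfAlgebra.antipode K a ∈ component g⁻¹
  action : Γ → A ≃ₐc[K] A
  action_one : ∀ a, action 1 a = a
  action_mul : ∀ g h a, action (g * h) a = action g (action h a)
  action_mem : ∀ g h, ∀ a ∈ component h, action g a ∈ component h

namespace InvariantCocentralAction
variable {K Γ A : Type*} [Field K] [Group Γ] [Ring A] [HopfAlgebra K A]

/-- The crossed product `A ⋊ Γ`, with elements `∑ a_g ⊗ g` and multiplication
`(a ⊗ g) (b ⊗ h) = a α_g(b) ⊗ gh`. -/
def CrossedProduct (_c : InvariantCocentralAction K Γ A) : Type _ := SkewMonoidAlgebra A Γ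

variable (c : InvariantCocentralAction K Γ A)

/-- The action of `Γ` on the ring `A`. -/
@[reducible] noncomputable def mulSemiringAction : MulSemiringAction Γ A where
  smul g a := c.action g a
  one_smul := c.action_one
  mul_smul := c.action_mul
  smul_zero g := map_zero (c.action g)
  smul_add g := map_add (c.action g)
  smul_one g := map_one (c.action g)
  smul_mul g := map_mul (c.action g)

noncomputable instance : Ring c.CrossedProduct :=
  letI := c.mulSemiringAction
  inferInstanceAs (Ring (SkewMonoidAlgebra A Γ))

noncomputable instance : Module K c.CrossedProduct :=
  inferInstanceAs (Module K (SkewMonoidAlgebra A Γ))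

namespace CrossedProduct
/-- The element `a ⊗ g`. -/
noncomputable def single (g : Γ) : A →ₗ[K] c.CrossedProduct where
  toFun a := SkewMonoidAlgebra.single g a
  map_add' := SkewMonoidAlgebra.single_add g
  map_smul' r a := (SkewMonoidAlgebra.smul_single r g a).symm

/-- The coefficient of `g`. -/
noncomputable def coeff (g : Γ) : c.CrossedProduct →ₗ[K] A where
  toFun u := SkewMonoidAlgebra.coeff u g
  map_add' u v := congrArg (fun f : Γ →₀ A => f g) (SkewMonoidAlgebra.coeff_add u v)
  map_smul' r u := congrArg (fun f : Γ →₀ A => f g) (SkewMonoidAlgebra.coeff_smul r u)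

variable {c}

open Classical in
theorem coeff_single (g h : Γ) (a : A) :
    coeff c h (single c g a) = if g = h then a else 0 := by
  change SkewMonoidAlgebra.coeff (SkewMonoidAlgebra.single g a) h = _
  rw [SkewMonoidAlgebra.coeff_single_apply]

theorem ext_coeff {u v : c.CrossedProduct} (h : ∀ g, coeff c g u = coeff c g v) : u = v := by
  apply SkewMonoidAlgebra.ext
  exact h

@[elab_as_elim]
theorem induction_on {p : c.CrossedProduct → Prop} (u : c.CrossedProduct) (zero : p 0)
    (single : ∀ g a, p (single c g a)) (add : ∀ u v, p u → p v → p (u + v)) : p u :=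
  SkewMonoidAlgebra.induction_on u zero single fun u v => add u v

theorem single_mul_single (g h : Γ) (a b : A) :
    single c g a * single c h b = single c (g * h) (a * c.action g b) :=
  letI := c.mulSemiringAction
  SkewMonoidAlgebra.single_mul_single

theorem one_eq_single : (1 : c.CrossedProduct) = single c 1 1 := rfl

end CrossedProduct

open CrossedProduct

noncomputable instance : Algebra K c.CrossedProduct :=
  Algebra.ofModule
    (fun r x y => by
      induction x using CrossedProduct.induction_on with
      | zero => simp
      | add u v hu hv => simp only [smul_add, add_mul, hu, hv]
      | single g a =>
        induction y using CrossedProduct.induction_on with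
        | zero => simp
        | add u v hu hv => simp only [smul_add, mul_add, hu, hv]
        | single h b => rw [← map_smul, single_mul_single, single_mul_single, ← map_smul,
            smul_mul_assoc])
    (fun r x y => by
      induction x using CrossedProduct.induction_on with
      | zero => simp
      | add u v hu hv => simp only [smul_add, add_mul, hu, hv]
      | single g a =>
        induction y using CrossedProduct.induction_on with
        | zero => simp
        | add u v hu hv => simp only [smul_add, mul_add, hu, hv]
        | single h b => rw [← map_smul, single_mul_single, single_mul_single, ← map_smul,
            map_smul, mul_smul_comm])

/-- The elements `u` with `u_g ∈ A_g` for all `g` are the finite sums of such `a ⊗ g`. -/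
theorem twist_induction {p : c.CrossedProduct → Prop} (u : c.CrossedProduct)
    (hu : ∀ g, coeff c g u ∈ c.component g) (zero : p 0)
    (single : ∀ g, ∀ a ∈ c.component g, p (single c g a))
    (add : ∀ u v, p u → p v → p (u + v)) : p u := by
  have h : SkewMonoidAlgebra.sum (k := A) (G := Γ) u SkewMonoidAlgebra.single = u :=
    SkewMonoidAlgebra.sum_single (k := A) (G := Γ) u
  replace h : ∑ g ∈ (SkewMonoidAlgebra.coeff (k := A) (G := Γ) u).support,
    CrossedProduct.single c g (coeff c g u) = u := h
  rw [← h]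
  exact Finset.sum_induction _ p add zero fun g _ => single g _ (hu g)

/-- The subalgebra `∑ A_g ⊗ g` of the crossed product `A ⋊ Γ`. -/
def twistSubalgebra : Subalgebra K c.CrossedProduct where
  carrier := {u | ∀ g, coeff c g u ∈ c.component g}
  add_mem' hu hv g := by rw [map_add]; exact add_mem (hu g) (hv g)
  zero_mem' g := by rw [map_zero]; exact zero_mem _
  algebraMap_mem' r g := by
    classical
    rw [Algebra.algebraMap_eq_smul_one, map_smul, one_eq_single, coeff_single]
    split_ifs with h
    · exact h ▸ Submodule.smul_mem _ _ c.one_mem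
    · rw [smul_zero]; exact zero_mem _
  mul_mem' {u v} hu hv g := by
    classical
    refine c.twist_induction (p := fun u => coeff c g (u * v) ∈ c.component g) u hu
      (by simp) (fun h a ha => ?_) fun u v hu hv => by
        rw [add_mul, map_add]; exact add_mem hu hv
    refine c.twist_induction (p := fun v => coeff c g (single c h a * v) ∈ c.component g) v hv
      (by simp) (fun k b hb => ?_) fun u v hu hv => by
        rw [mul_add, map_add]; exact add_mem hu hv
    rw [single_mul_single, coeff_single]
    split_ifs with hg
    · exact hg ▸ c.mul_mem _ _ _ ha _ (c.action_mem _ _ _ hb)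
    · exact zero_mem _

/-- The graded twisting `A^{t,α} = ∑ A_g ⊗ g ⊆ A ⋊ Γ`. -/
def GradedTwist : Type _ := ↥c.twistSubalgebra

namespace GradedTwist

noncomputable instance : Ring c.GradedTwist := inferInstanceAs (Ring ↥c.twistSubalgebra)

noncomputable instance : Algebra K c.GradedTwist := inferInstanceAs (Algebra K ↥c.twistSubalgebra)

/-- The inclusion `A^{t,α} → A ⋊ Γ`. -/
noncomputable def val : c.GradedTwist →ₐ[K] c.CrossedProduct := c.twistSubalgebra.val

theorem val_injective : Function.Injective (val c) := Subtype.val_injective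

/-- The map `∑ a_g ⊗ g ↦ ∑ a_g`. -/
noncomputable def total : c.GradedTwist →ₗ[K] A :=
  (Finsupp.lsum K fun _ => LinearMap.id) ∘ₗ
    ((SkewMonoidAlgebra.coeffLinearEquiv (k := A) (G := Γ) (S := K)).toLinearMap ∘ₗ
      (val c).toLinearMap)

variable {c} in
/-- The element `a ⊗ g` for `a ∈ A_g`. -/
noncomputable def of (g : Γ) (a : A) (ha : a ∈ c.component g) : c.GradedTwist :=
  ⟨single c g a, fun h => by
    classical
    rw [coeff_single]
    split_ifs with hg
    · exact hg ▸ ha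
    · exact zero_mem _⟩

variable {c} in
@[simp] theorem val_of (g : Γ) (a : A) (ha) : val c (of g a ha) = single c g a := rfl

theorem total_of (g : Γ) (a : A) (ha) : total c (of g a ha) = a :=
  Finsupp.sum_single_index (h := fun _ a => a) rfl

theorem total_injective : Function.Injective (total c) := by
  rw [← LinearMap.ker_eq_bot, LinearMap.ker_eq_bot']
  intro u hu
  have h := (iSupIndep_iff_finsetSum_eq_zero_imp_eq_zero _).1 c.iSupIndep_component
    (SkewMonoidAlgebra.coeff (k := A) (G := Γ) (val c u)).support
    (fun g => coeff c g (val c u)) (fun g _ => u.2 g) hu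
  apply val_injective
  refine ext_coeff fun g => ?_
  rw [map_zero, map_zero]
  by_contra hg
  exact hg (h g (Finsupp.mem_support_iff.2 hg))

theorem total_surjective : Function.Surjective (total c) := by
  rw [← LinearMap.range_eq_top, eq_top_iff, ← c.iSup_component, iSup_le_iff]
  exact fun g a ha => ⟨of g a ha, total_of c g a ha⟩

/-- The linear isomorphism `j : A → A^{t,α}`, `∑ a_g ↦ ∑ a_g ⊗ g`. -/
noncomputable def j : A ≃ₗ[K] c.GradedTwist :=
  (LinearEquiv.ofBijective (total c) ⟨total_injective c, total_surjective c⟩).symm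

variable {c}

theorem j_eq (g : Γ) (a : A) (ha : a ∈ c.component g) : j c a = of g a ha := by
  rw [j, LinearEquiv.symm_apply_eq]
  exact (total_of c g a ha).symm

theorem j_mul (g : Γ) (a b : A) (ha : a ∈ c.component g) :
    j c a * j c b = j c (a * c.action g b) := by
  have hb : b ∈ ⨆ h, c.component h := by rw [c.iSup_component]; trivial
  induction hb using Submodule.iSup_induction' with
  | zero => simp
  | add x y _ _ hx hy => simp only [map_add, mul_add, hx, hy]
  | mem h b hb =>
    rw [j_eq g a ha, j_eq h b hb, j_eq (g * h) _ (c.mul_mem _ _ _ ha _ (c.action_mem _ _ _ hb))]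
    exact val_injective c (by rw [map_mul, val_of, val_of, val_of, single_mul_single])

theorem j_one : j c 1 = 1 := j_eq 1 1 c.one_mem

theorem homogeneous_induction {p : A → Prop} (a : A)
    (mem : ∀ g, ∀ a ∈ c.component g, p a) (add : ∀ a b, p a → p b → p (a + b)) : p a := by
  have ha : a ∈ ⨆ h, c.component h := by rw [c.iSup_component]; trivial
  induction ha using Submodule.iSup_induction' with
  | zero => exact mem 1 0 (zero_mem _)
  | add x y _ _ hx hy => exact add x y hx hy
  | mem h b hb => exact mem h b hb

noncomputable instance : CoalgebraStruct K c.GradedTwist where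
  comul := TensorProduct.map (j c).toLinearMap (j c).toLinearMap ∘ₗ Coalgebra.comul ∘ₗ
    (j c).symm.toLinearMap
  counit := Coalgebra.counit ∘ₗ (j c).symm.toLinearMap

theorem comul_j (a : A) : Coalgebra.comul (R := K) (j c a) =
    TensorProduct.map (j c).toLinearMap (j c).toLinearMap (Coalgebra.comul (R := K) a) := by
  change TensorProduct.map _ _ (Coalgebra.comul ((j c).symm (j c a))) = _
  rw [LinearEquiv.symm_apply_apply]

theorem counit_j (a : A) : Coalgebra.counit (R := K) (j c a) = Coalgebra.counit (R := K) a := by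
  change Coalgebra.counit ((j c).symm (j c a)) = _
  rw [LinearEquiv.symm_apply_apply]

theorem assoc_rTensor_comul (t : A ⊗[K] A) :
    TensorProduct.assoc K _ _ _ ((Coalgebra.comul (R := K) (A := c.GradedTwist)).rTensor _
      (TensorProduct.map (j c).toLinearMap (j c).toLinearMap t)) =
    TensorProduct.map (j c).toLinearMap (TensorProduct.map (j c).toLinearMap (j c).toLinearMap)
      (TensorProduct.assoc K _ _ _ ((Coalgebra.comul (R := K) (A := A)).rTensor _ t)) := by
  induction t with
  | zero => simp
  | add s t hs ht => simp only [map_add, hs, ht]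
  | tmul a b =>
    simp only [TensorProduct.map_tmul, LinearMap.rTensor_tmul, LinearEquiv.coe_coe, comul_j]
    induction Coalgebra.comul (R := K) a with
    | zero => simp
    | add s t hs ht => simp only [map_add, TensorProduct.add_tmul, hs, ht]
    | tmul x y => simp

theorem lTensor_comul (t : A ⊗[K] A) :
    (Coalgebra.comul (R := K) (A := c.GradedTwist)).lTensor _
      (TensorProduct.map (j c).toLinearMap (j c).toLinearMap t) =
    TensorProduct.map (j c).toLinearMap (TensorProduct.map (j c).toLinearMap (j c).toLinearMap)
      ((Coalgebra.comul (R := K) (A := A)).lTensor _ t) := by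
  induction t with
  | zero => simp
  | add s t hs ht => simp only [map_add, hs, ht]
  | tmul a b => simp [comul_j]

theorem rTensor_counit (t : A ⊗[K] A) :
    (Coalgebra.counit (R := K) (A := c.GradedTwist)).rTensor _
      (TensorProduct.map (j c).toLinearMap (j c).toLinearMap t) =
    (j c).toLinearMap.lTensor K ((Coalgebra.counit (R := K) (A := A)).rTensor _ t) := by
  induction t with
  | zero => simp
  | add s t hs ht => simp only [map_add, hs, ht]
  | tmul a b => simp [counit_j]

theorem lTensor_counit (t : A ⊗[K] A) :
    (Coalgebra.counit (R := K) (A := c.GradedTwist)).lTensor _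
      (TensorProduct.map (j c).toLinearMap (j c).toLinearMap t) =
    (j c).toLinearMap.rTensor K ((Coalgebra.counit (R := K) (A := A)).lTensor _ t) := by
  induction t with
  | zero => simp
  | add s t hs ht => simp only [map_add, hs, ht]
  | tmul a b => simp [counit_j]

/-- The coalgebra structure on `A^{t,α}` transported from `A` along `j`. -/
noncomputable instance : Coalgebra K c.GradedTwist where
  coassoc := LinearMap.ext fun u => by
    obtain ⟨a, rfl⟩ := (j c).surjective u
    simp only [LinearMap.comp_apply, LinearEquiv.coe_coe, comul_j]
    rw [assoc_rTensor_comul, lTensor_comul, Coalgebra.coassoc_apply]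
  rTensor_counit_comp_comul := LinearMap.ext fun u => by
    obtain ⟨a, rfl⟩ := (j c).surjective u
    simp only [LinearMap.comp_apply, comul_j]
    rw [rTensor_counit, Coalgebra.rTensor_counit_comul]
    rfl
  lTensor_counit_comp_comul := LinearMap.ext fun u => by
    obtain ⟨a, rfl⟩ := (j c).surjective u
    simp only [LinearMap.comp_apply, comul_j]
    rw [lTensor_counit, Coalgebra.lTensor_counit_comul]
    rfl

theorem map_j_mul (g : Γ) (s t : A ⊗[K] A)
    (hs : s ∈ LinearMap.range
      (TensorProduct.map (c.component g).subtype (c.component g).subtype)) :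
    TensorProduct.map (j c).toLinearMap (j c).toLinearMap s *
      TensorProduct.map (j c).toLinearMap (j c).toLinearMap t =
    TensorProduct.map (j c).toLinearMap (j c).toLinearMap
      (s * TensorProduct.map (c.action g : A →ₗc[K] A).toLinearMap
        (c.action g : A →ₗc[K] A).toLinearMap t) := by
  obtain ⟨s, rfl⟩ := hs
  induction s with
  | zero => simp
  | add x y hx hy => simp only [map_add, add_mul, hx, hy]
  | tmul a b =>
    induction t with
    | zero => simp
    | add x y hx hy => simp only [map_add, mul_add, hx, hy]
    | tmul x y => simp [j_mul g _ _ a.2, j_mul g _ _ b.2]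

noncomputable instance : Bialgebra K c.GradedTwist :=
  Bialgebra.mk' K _
    (by rw [← j_one, counit_j, Bialgebra.counit_one])
    (fun {u v} => by
      obtain ⟨a, rfl⟩ := (j c).surjective u
      obtain ⟨b, rfl⟩ := (j c).surjective v
      induction a using homogeneous_induction (c := c) with
      | add x y hx hy => simp only [map_add, add_mul, hx, hy]
      | mem g a ha =>
        rw [j_mul g a b ha, counit_j, counit_j, counit_j, Bialgebra.counit_mul]
        congr 1
        exact CoalgHomClass.counit_comp_apply (c.action g) b)
    (by
      rw [← j_one, comul_j, Bialgebra.comul_one, Algebra.TensorProduct.one_def,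
        TensorProduct.map_tmul, LinearEquiv.coe_coe, j_one]
      rfl)
    (fun {u v} => by
      obtain ⟨a, rfl⟩ := (j c).surjective u
      obtain ⟨b, rfl⟩ := (j c).surjective v
      induction a using homogeneous_induction (c := c) with
      | add x y hx hy => simp only [map_add, add_mul, hx, hy]
      | mem g a ha =>
        rw [j_mul g a b ha, comul_j, comul_j, comul_j, Bialgebra.comul_mul,
          map_j_mul g _ _ (c.comul_mem g a ha)]
        congr 2
        exact (CoalgHomClass.map_comp_comul_apply (c.action g) b).symm)

/-- The antipode `a ⊗ g ↦ α_{g⁻¹}(S(a)) ⊗ g⁻¹`. -/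
noncomputable def antipodeHom : c.GradedTwist →ₗ[K] c.GradedTwist :=
  (Finsupp.lsum K fun g => (j c).toLinearMap ∘ₗ
    (c.action g⁻¹ : A →ₗc[K] A).toLinearMap ∘ₗ HopfAlgebra.antipode K) ∘ₗ
    ((SkewMonoidAlgebra.coeffLinearEquiv (k := A) (G := Γ) (S := K)).toLinearMap ∘ₗ
      (val c).toLinearMap)

theorem antipodeHom_j (g : Γ) (a : A) (ha : a ∈ c.component g) :
    antipodeHom (j c a) = j c (c.action g⁻¹ (HopfAlgebra.antipode K a)) := by
  rw [j_eq g a ha]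
  exact Finsupp.sum_single_index (h := fun g a => (j c) (c.action g⁻¹ (HopfAlgebra.antipode K a)))
    (by simp)

theorem mul_antipode_left (g : Γ) (s : A ⊗[K] A)
    (hs : s ∈ LinearMap.range
      (TensorProduct.map (c.component g).subtype (c.component g).subtype)) :
    LinearMap.mul' K c.GradedTwist (antipodeHom.rTensor _
      (TensorProduct.map (j c).toLinearMap (j c).toLinearMap s)) =
    j c (c.action g⁻¹ (LinearMap.mul' K A ((HopfAlgebra.antipode K).rTensor A s))) := by
  obtain ⟨s, rfl⟩ := hs
  induction s with
  | zero => simp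
  | add x y hx hy => simp only [map_add, hx, hy]
  | tmul a b =>
    simp only [TensorProduct.map_tmul, LinearMap.rTensor_tmul, LinearEquiv.coe_coe,
      Submodule.subtype_apply, LinearMap.mul'_apply]
    rw [antipodeHom_j g _ a.2, j_mul g⁻¹ _ _ (c.action_mem _ _ _ (c.antipode_mem g _ a.2)),
      ← map_mul (c.action g⁻¹)]

theorem mul_antipode_right (g : Γ) (s : A ⊗[K] A)
    (hs : s ∈ LinearMap.range
      (TensorProduct.map (c.component g).subtype (c.component g).subtype)) :
    LinearMap.mul' K c.GradedTwist (antipodeHom.lTensor _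
      (TensorProduct.map (j c).toLinearMap (j c).toLinearMap s)) =
    j c (LinearMap.mul' K A ((HopfAlgebra.antipode K).lTensor A s)) := by
  obtain ⟨s, rfl⟩ := hs
  induction s with
  | zero => simp
  | add x y hx hy => simp only [map_add, hx, hy]
  | tmul a b =>
    simp only [TensorProduct.map_tmul, LinearMap.lTensor_tmul, LinearEquiv.coe_coe,
      Submodule.subtype_apply, LinearMap.mul'_apply]
    rw [antipodeHom_j g _ b.2, j_mul g _ _ a.2, ← c.action_mul, mul_inv_cancel, c.action_one]

/-- The graded twisting `A^{t,α}` is a Hopf algebra. -/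
noncomputable instance : HopfAlgebra K c.GradedTwist where
  antipode := antipodeHom
  mul_antipode_rTensor_comul := LinearMap.ext fun u => by
    obtain ⟨a, rfl⟩ := (j c).surjective u
    induction a using homogeneous_induction (c := c) with
    | add x y hx hy => simp only [map_add, hx, hy]
    | mem g a ha =>
      simp only [LinearMap.comp_apply, comul_j, counit_j]
      rw [mul_antipode_left g _ (c.comul_mem g a ha),
        HopfAlgebra.mul_antipode_rTensor_comul_apply, Algebra.linearMap_apply,
        Algebra.algebraMap_eq_smul_one, Algebra.algebraMap_eq_smul_one, map_smul, map_one,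
        map_smul, j_one]
  mul_antipode_lTensor_comul := LinearMap.ext fun u => by
    obtain ⟨a, rfl⟩ := (j c).surjective u
    induction a using homogeneous_induction (c := c) with
    | add x y hx hy => simp only [map_add, hx, hy]
    | mem g a ha =>
      simp only [LinearMap.comp_apply, comul_j, counit_j]
      rw [mul_antipode_right g _ (c.comul_mem g a ha),
        HopfAlgebra.mul_antipode_lTensor_comul_apply, Algebra.linearMap_apply,
        Algebra.algebraMap_eq_smul_one, Algebra.algebraMap_eq_smul_one, map_smul, j_one]

end GradedTwist
end InvariantCocentralAction

/-! ### Invariant cocentral actions on affine algebraic groups -/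

/-- An invariant cocentral action `(i, α)` of an abelian group `Γ` on an affine algebraic group `G`:
an injective homomorphism `i` from the dual group `Γ̂ = Hom(Γ, Kˣ)` to the centre of `G` (for finite
`Γ` it is automatically a morphism of algebraic groups), and an action `α` of `Γ` on `G` by
automorphisms of the algebraic group `G` that fix `i(Γ̂)` pointwise. -/
structure GroupCocentralAction (K Γ G : Type*) [Field K] [CommGroup Γ] [Group G]
    [AffineAlgebraicGroup K G] where
  i : (Γ →* Kˣ) →* G
  i_injective : Function.Injective i
  i_central : ∀ ψ, i ψ ∈ Subgroup.center G
  α : Γ →* MulAut G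
  α_regular : ∀ g, ∀ f ∈ AffineAlgebraicGroup.regular (K := K) (G := G),
    (fun x => f (α g x)) ∈ AffineAlgebraicGroup.regular (K := K) (G := G)
  α_i : ∀ g ψ, α g (i ψ) = i ψ

namespace GroupCocentralAction
variable {K Γ G : Type*} [Field K] [CommGroup Γ] [Group G]
    [AffineAlgebraicGroup K G] (act : GroupCocentralAction K Γ G)

theorem i_comm (ψ : Γ →* Kˣ) (x : G) : x * act.i ψ = act.i ψ * x :=
  Subgroup.mem_center_iff.1 (act.i_central ψ) x

/-- The Hopf algebra automorphism `a ↦ a ∘ α_{g⁻¹}` of `𝒪(G)`. -/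
noncomputable def hopfAction (g : Γ) : CoordRing K G ≃ₐc[K] CoordRing K G :=
  BialgEquiv.ofAlgEquiv
    (AlgEquiv.ofAlgHom
      { toFun := fun f => CoordRing.mk K (fun x => f (act.α g⁻¹ x)) (act.α_regular _ _ f.mem_regular)
        map_one' := rfl
        map_mul' := fun _ _ => rfl
        map_zero' := rfl
        map_add' := fun _ _ => rfl
        commutes' := fun _ => rfl }
      { toFun := fun f => CoordRing.mk K (fun x => f (act.α g x)) (act.α_regular _ _ f.mem_regular)
        map_one' := rfl
        map_mul' := fun _ _ => rfl
        map_zero' := rfl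
        map_add' := fun _ _ => rfl
        commutes' := fun _ => rfl }
      (AlgHom.ext fun f => CoordRing.ext_eval fun x => by
        change f (act.α g (act.α g⁻¹ x)) = f x
        rw [← MulAut.mul_apply, ← map_mul, mul_inv_cancel, map_one, MulAut.one_apply])
      (AlgHom.ext fun f => CoordRing.ext_eval fun x => by
        change f (act.α g⁻¹ (act.α g x)) = f x
        rw [← MulAut.mul_apply, ← map_mul, inv_mul_cancel, map_one, MulAut.one_apply]))
    (AlgHom.ext fun f => by
      change f (act.α g⁻¹ 1) = f 1
      rw [map_one])
    (AlgHom.ext fun f => CoordRing.ext_eval₂ fun x y => by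
      have h : ∀ (φ : CoordRing K G →ₐ[K] CoordRing K G)
          (hφ : ∀ f x, φ f x = f (act.α g⁻¹ x)) (t : CoordRing K G ⊗[K] CoordRing K G),
          CoordRing.eval₂ K x y (Algebra.TensorProduct.map φ φ t) =
            CoordRing.eval₂ K (act.α g⁻¹ x) (act.α g⁻¹ y) t := by
        intro φ hφ t
        induction t with
        | zero => simp
        | add s t hs ht => simp only [map_add, hs, ht]
        | tmul a b => simp [hφ]
      refine (h _ (fun f x => rfl) (CoordRing.comulHom f)).trans ?_
      refine Eq.trans ?_ (CoordRing.eval₂_comulHom _ x y).symm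
      rw [CoordRing.eval₂_comulHom, ← map_mul]
      rfl)

@[simp] theorem hopfAction_apply (g : Γ) (f : CoordRing K G) (x : G) :
    act.hopfAction g f x = f (act.α g⁻¹ x) := rfl

/-- The homogeneous component
`𝒪(G)_g = {a | a (i(ψ) x) = ψ(g) a(x) for all x ∈ G, ψ ∈ Γ̂}`. -/
def component (g : Γ) : Submodule K (CoordRing K G) where
  carrier := {a | ∀ (ψ : Γ →* Kˣ) (x : G), a (act.i ψ * x) = (ψ g : K) * a x}
  add_mem' ha hb ψ x := by simp [ha ψ x, hb ψ x, mul_add]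
  zero_mem' ψ x := by simp
  smul_mem' r a ha ψ x := by simp [ha ψ x, mul_left_comm]

theorem mem_component {g : Γ} {a : CoordRing K G} : a ∈ act.component g ↔
    ∀ (ψ : Γ →* Kˣ) (x : G), a (act.i ψ * x) = (ψ g : K) * a x := Iff.rfl

instance : act.i.range.Normal where
  conj_mem := by
    rintro _ ⟨ψ, rfl⟩ x
    rw [act.i_comm, mul_inv_cancel_right]
    exact ⟨ψ, rfl⟩

/-- `H` is `Γ`-stable: globally invariant under all `α_g`. -/
def IsStable (H : Subgroup G) : Prop := ∀ g, ∀ x ∈ H, act.α g x ∈ H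

/-- The set `H_1 = {x ∈ H | Γ.x ⊆ i(Γ̂) x}`. -/
def stabilizedSubset (H : Subgroup G) : Set G :=
  {x | x ∈ H ∧ ∀ g : Γ, ∃ ψ : Γ →* Kˣ, act.α g x = act.i ψ * x}

/-- The invariant cocentral action on a `Γ`-stable algebraic subgroup `H` containing `i(Γ̂)`,
obtained by restricting `(i, α)`. -/
def restrict (H : AlgebraicSubgroup K G) (hi : act.i.range ≤ H.toSubgroup)
    (hα : act.IsStable H.toSubgroup) : GroupCocentralAction K Γ H.toSubgroup where
  i := act.i.codRestrict H.toSubgroup fun ψ => hi ⟨ψ, rfl⟩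
  i_injective ψ φ h := act.i_injective (congrArg Subtype.val h)
  i_central ψ := Subgroup.mem_center_iff.2 fun x => Subtype.ext (act.i_comm ψ x)
  α :=
    { toFun := fun g =>
        { toFun := fun x => ⟨act.α g x, hα g x x.2⟩
          invFun := fun x => ⟨act.α g⁻¹ x, hα g⁻¹ x x.2⟩
          left_inv := fun x => Subtype.ext (by simp)
          right_inv := fun x => Subtype.ext (by simp)
          map_mul' := fun x y => Subtype.ext (map_mul (act.α g) x.1 y.1) }
      map_one' := MulEquiv.ext fun x => Subtype.ext (by simp)
      map_mul' := fun g h => MulEquiv.ext fun x => Subtype.ext (by simp) }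
  α_regular g := by
    rintro _ ⟨f, hf, rfl⟩
    exact ⟨_, act.α_regular g f hf, rfl⟩
  α_i g ψ := Subtype.ext (act.α_i g ψ)

variable [IsAlgClosed K] [CharZero K] [Finite Γ]

instance finite_dual : Finite (Γ →* Kˣ) := by
  have : NeZero (Monoid.exponent Γ) := ⟨Monoid.exponent_ne_zero_of_finite⟩
  exact (CommGroup.monoidHom_mulEquiv_of_hasEnoughRootsOfUnity Γ K).some.symm.finite_iff.1 ‹_›

instance finite_range : Finite act.i.range :=
  Set.finite_range act.i

theorem card_dual : Nat.card (Γ →* Kˣ) = Nat.card Γ := by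
  have : NeZero (Monoid.exponent Γ) := ⟨Monoid.exponent_ne_zero_of_finite⟩
  exact CommGroup.card_monoidHom_of_hasEnoughRootsOfUnity Γ K

theorem sum_dual [Fintype (Γ →* Kˣ)] (g : Γ) (hg : g ≠ 1) :
    ∑ ψ : Γ →* Kˣ, (ψ g : K) = 0 := by
  have : NeZero (Monoid.exponent Γ) := ⟨Monoid.exponent_ne_zero_of_finite⟩
  obtain ⟨φ, hφ⟩ := CommGroup.exists_apply_ne_one_of_hasEnoughRootsOfUnity Γ K hg
  have h1 : (φ g : K) * ∑ ψ : Γ →* Kˣ, (ψ g : K) = ∑ ψ : Γ →* Kˣ, (ψ g : K) := by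
    rw [Finset.mul_sum]
    exact Fintype.sum_equiv (Equiv.mulLeft φ) _ _ fun ψ => by simp
  have h2 : ((φ g : K) - 1) * ∑ ψ : Γ →* Kˣ, (ψ g : K) = 0 := by rw [sub_mul, h1]; simp
  refine (mul_eq_zero.1 h2).resolve_left fun h => hφ (Units.ext ?_)
  simpa [sub_eq_zero] using h

/-- The projection onto the component of degree `g`. -/
noncomputable def proj [Fintype (Γ →* Kˣ)] (g : Γ) : CoordRing K G →ₗ[K] CoordRing K G where
  toFun a := CoordRing.mk K
    (fun x => (Nat.card Γ : K)⁻¹ * ∑ ψ : Γ →* Kˣ, ((ψ g)⁻¹ : Kˣ) * a (act.i ψ * x)) (by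
      have : (fun x => (Nat.card Γ : K)⁻¹ * ∑ ψ : Γ →* Kˣ, ((ψ g)⁻¹ : Kˣ) * a (act.i ψ * x)) =
          (Nat.card Γ : K)⁻¹ • ∑ ψ : Γ →* Kˣ, (((ψ g)⁻¹ : Kˣ) : K) • fun x => a (act.i ψ * x) := by
        funext x; simp
      rw [this]
      exact Subalgebra.smul_mem _ (Subalgebra.sum_mem _ fun ψ _ => Subalgebra.smul_mem _
        (AffineAlgebraicGroup.regular_mul_left _ a.mem_regular _) _) _)
  map_add' a b := CoordRing.ext_eval fun x => by
    simp [mul_add, Finset.sum_add_distrib]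
  map_smul' r a := CoordRing.ext_eval fun x => by
    simp only [CoordRing.eval_apply, CoordRing.mk_apply, CoordRing.smul_apply, RingHom.id_apply,
      Finset.mul_sum]
    exact Finset.sum_congr rfl fun ψ _ => by ring

theorem proj_apply [Fintype (Γ →* Kˣ)] (g : Γ) (a : CoordRing K G) (x : G) : act.proj g a x =
    (Nat.card Γ : K)⁻¹ * ∑ ψ : Γ →* Kˣ, ((ψ g)⁻¹ : Kˣ) * a (act.i ψ * x) := rfl

theorem card_ne_zero : (Nat.card Γ : K) ≠ 0 := Nat.cast_ne_zero.2 Nat.card_pos.ne'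

theorem proj_mem [Fintype (Γ →* Kˣ)] (g : Γ) (a : CoordRing K G) :
    act.proj g a ∈ act.component g := by
  intro φ x
  rw [proj_apply, proj_apply, mul_left_comm]
  congr 1
  rw [Finset.mul_sum]
  refine Fintype.sum_equiv (Equiv.mulRight φ) _ _ fun ψ => ?_
  have : (φ g : K) ≠ 0 := Units.ne_zero _
  simp [mul_assoc]

theorem proj_of_mem [Fintype (Γ →* Kˣ)] [DecidableEq Γ] (g h : Γ) (a : CoordRing K G)
    (ha : a ∈ act.component h) : act.proj g a = if h = g then a else 0 := by
  refine CoordRing.ext_eval fun x => ?_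
  have h1 : ∀ ψ : Γ →* Kˣ, (((ψ g)⁻¹ : Kˣ) : K) * a (act.i ψ * x) =
      ((ψ (g⁻¹ * h) : Kˣ) : K) * a x := fun ψ => by
    rw [ha ψ x]; simp [mul_assoc]
  rw [CoordRing.eval_apply, proj_apply]
  simp only [h1, ← Finset.sum_mul]
  split_ifs with hg
  · subst hg
    have h2 := card_dual (K := K) (Γ := Γ)
    rw [Nat.card_eq_fintype_card] at h2
    simp [h2, inv_mul_cancel_left₀ (card_ne_zero (K := K) (Γ := Γ))]
  · rw [sum_dual _ fun h' => hg (inv_mul_eq_one.1 h').symm]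
    simp

theorem sum_proj [Fintype (Γ →* Kˣ)] [Fintype Γ] (a : CoordRing K G) :
    ∑ g, act.proj g a = a := by
  classical
  refine CoordRing.ext_eval fun x => ?_
  simp only [map_sum, CoordRing.eval_apply, proj_apply, ← Finset.mul_sum]
  rw [Finset.sum_comm]
  have h1 : ∀ ψ : Γ →* Kˣ, ∑ g : Γ, (((ψ g)⁻¹ : Kˣ) : K) * a (act.i ψ * x) =
      if ψ = 1 then (Nat.card Γ : K) * a x else 0 := by
    intro ψ
    rw [← Finset.sum_mul]
    split_ifs with hψ
    · subst hψ; simp [Nat.card_eq_fintype_card]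
    · have := sum_hom_units_eq_zero ((Units.coeHom K).comp ψ⁻¹) (by
        intro h
        apply hψ
        refine MonoidHom.ext fun g => ?_
        have h2 : (ψ g)⁻¹ = 1 := Units.ext (DFunLike.congr_fun h g)
        exact inv_eq_one.1 h2)
      have h3 : ∑ g : Γ, (((ψ g)⁻¹ : Kˣ) : K) = 0 := this
      rw [h3, zero_mul]
  simp only [h1, Finset.sum_ite_eq', Finset.mem_univ, if_true]
  rw [inv_mul_cancel_left₀ (card_ne_zero (K := K) (Γ := Γ))]

theorem iSupIndep_component : iSupIndep act.component := by
  classical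
  have := Fintype.ofFinite (Γ →* Kˣ)
  rw [iSupIndep_iff_finsetSum_eq_zero_imp_eq_zero]
  intro s v hv hs g hg
  have h := congrArg (act.proj g) hs
  rw [map_sum, map_zero] at h
  rwa [Finset.sum_congr rfl fun k hk => act.proj_of_mem g k (v k) (hv k hk),
    Finset.sum_ite_eq', if_pos hg] at h

theorem iSup_component : ⨆ g, act.component g = ⊤ := by
  have := Fintype.ofFinite (Γ →* Kˣ)
  have := Fintype.ofFinite Γ
  rw [eq_top_iff]
  intro a _
  rw [← act.sum_proj a]
  exact Submodule.sum_mem _ fun g _ => Submodule.mem_iSup_of_mem g (act.proj_mem g a)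

theorem comul_mem_component (g : Γ) (a : CoordRing K G) (ha : a ∈ act.component g) :
    Coalgebra.comul (R := K) a ∈ LinearMap.range
      (TensorProduct.map (act.component g).subtype (act.component g).subtype) := by
  have := Fintype.ofFinite (Γ →* Kˣ)
  let P : CoordRing K G →ₗ[K] act.component g :=
    (act.proj g).codRestrict _ (act.proj_mem g)
  refine ⟨TensorProduct.map P P (Coalgebra.comul (R := K) a), ?_⟩
  rw [← LinearMap.comp_apply, ← TensorProduct.map_comp]
  refine CoordRing.ext_eval₂ fun x y => ?_
  have h : ∀ t : CoordRing K G ⊗[K] CoordRing K G,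
      CoordRing.eval₂ K x y (TensorProduct.map ((act.component g).subtype ∘ₗ P)
        ((act.component g).subtype ∘ₗ P) t) =
      (Nat.card Γ : K)⁻¹ * (Nat.card Γ : K)⁻¹ * ∑ ψ : Γ →* Kˣ, ∑ φ : Γ →* Kˣ,
        ((ψ g)⁻¹ : Kˣ) * ((φ g)⁻¹ : Kˣ) *
          CoordRing.eval₂ K (act.i ψ * x) (act.i φ * y) t := by
    intro t
    induction t with
    | zero => simp
    | add s t hs ht => simp only [map_add, hs, ht, mul_add, Finset.sum_add_distrib]
    | tmul u v =>
      rw [TensorProduct.map_tmul, CoordRing.eval₂_tmul]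
      change act.proj g u x * act.proj g v y = _
      rw [proj_apply, proj_apply, mul_mul_mul_comm, Finset.sum_mul_sum]
      congr 1
      refine Finset.sum_congr rfl fun ψ _ => Finset.sum_congr rfl fun φ _ => ?_
      rw [CoordRing.eval₂_tmul]; ring
  have h1 : ∀ ψ φ : Γ →* Kˣ, (((ψ g)⁻¹ : Kˣ) : K) * ((φ g)⁻¹ : Kˣ) *
      CoordRing.eval₂ K (act.i ψ * x) (act.i φ * y) (Coalgebra.comul (R := K) a) = a (x * y) := by
    intro ψ φ
    have h2 : CoordRing.eval₂ K (act.i ψ * x) (act.i φ * y) (Coalgebra.comul (R := K) a) =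
        a (act.i ψ * x * (act.i φ * y)) := CoordRing.eval₂_comulHom a _ _
    have h3 : act.i ψ * x * (act.i φ * y) = act.i ψ * (act.i φ * (x * y)) := by
      rw [mul_assoc, ← mul_assoc x, act.i_comm, mul_assoc]
    rw [h2, h3, ha, ha]
    simp only [Units.val_inv_eq_inv_val]
    have := (ψ g).ne_zero
    have := (φ g).ne_zero
    field_simp
  rw [h]
  simp only [h1]
  have h4 := card_dual (K := K) (Γ := Γ)
  rw [Nat.card_eq_fintype_card] at h4
  have h5 := card_ne_zero (K := K) (Γ := Γ)
  have h6 : CoordRing.eval₂ K x y (Coalgebra.comul (R := K) a) = a (x * y) :=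
    CoordRing.eval₂_comulHom a _ _
  rw [h6]
  simp only [Finset.sum_const, Finset.card_univ, h4, nsmul_eq_mul]
  field_simp

/-- The invariant cocentral action of `Γ` on the Hopf algebra `𝒪(G)` given by `(i, α)`. -/
noncomputable def toHopf : InvariantCocentralAction K Γ (CoordRing K G) where
  component := act.component
  iSupIndep_component := act.iSupIndep_component
  iSup_component := act.iSup_component
  one_mem ψ x := by simp
  mul_mem g h a ha b hb ψ x := by
    rw [CoordRing.mul_apply, CoordRing.mul_apply, ha, hb, map_mul, Units.val_mul]; ring
  comul_mem := act.comul_mem_component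
  antipode_mem g a ha ψ x := by
    change a (act.i ψ * x)⁻¹ = _ * a x⁻¹
    rw [mul_inv_rev, ← map_inv, act.i_comm, ha]
    simp
  action := act.hopfAction
  action_one a := CoordRing.ext_eval fun x => by simp
  action_mul g h a := CoordRing.ext_eval fun x => by
    rw [CoordRing.eval_apply, CoordRing.eval_apply, hopfAction_apply, hopfAction_apply,
      hopfAction_apply, ← MulAut.mul_apply, ← map_mul, mul_inv_rev]
  action_mem g h a ha ψ x := by
    rw [hopfAction_apply, map_mul, act.α_i, ha, hopfAction_apply]

/-- The Hopf algebra `𝒪(G^{t,α})`, the graded twisting of `𝒪(G)`. -/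
abbrev TwistedCoordRing : Type _ := act.toHopf.GradedTwist

end GroupCocentralAction

/-! Let `f` be the surjection onto `L`, and let `j` be the linear identification of `𝒪(G)` with its
twist. The images `L_g` of the homogeneous components are subcoalgebras of `L` that span `L`, with
`L_g L_h ⊆ L_{gh}` and `S(L_g) ⊆ L_{g⁻¹}`. Everything depends on whether they are independent
(`iSupIndep_image_or`).

If they are dependent, some `L_g` meets the sum of the others. An element `d` of the intersection
with `ε(d) = 1` then gives `1 = d₁ S(d₂) ∈ ∑_{k ≠ 1} L_k`. Since `1` is group-like, it lies in a
single `L_k` with `k ≠ 1`. As `Γ` has prime order, `k` generates it, so `1` lies in every `L_h` and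
`L = L_1`. In degree `1` nothing is twisted, so `L` is a quotient of `𝒪(G/i(Γ̂))`: this is the first
alternative.

If they are independent, the kernel of `f ∘ j` is graded. Commutativity of `𝒪(G)` makes it stable
under `Γ` (`map_action_eq_zero`), and stability makes it an ideal for the untwisted product
(`twistKer`). It is the kernel of a coalgebra map, hence a bi-ideal of `𝒪(G)`. By Cartier's theorem
in characteristic zero (`radical_eq`) it is the ideal of its zero set, a `Γ`-stable closed subgroup
`H` containing `i(Γ̂)`. Then `L` is the twist of `𝒪(H)`. That twist is commutative exactly when `H_1
= H` (`twist_restrict_commutative_iff`), which separates the second alternative from the third. -/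

/-! ### Hopf ideals of `𝒪(G)` in characteristic zero are radical -/

/-- If a derivation of a `ℚ`-algebra preserves an ideal, it preserves its radical. -/
theorem Derivation.mem_radical {K A : Type*} [Field K] [CharZero K] [CommRing A] [Algebra K A]
    (D : Derivation K A A) (J : Ideal A) (hD : ∀ a ∈ J, D a ∈ J) {y : A} (hy : y ∈ J.radical) :
    D y ∈ J.radical := by
  have key : ∀ m k : ℕ, y ^ m * D y ^ k ∈ J → D y ^ (k + 2 * m) ∈ J := by
    intro m
    induction m with
    | zero => intro k h; simpa using h
    | succ m ih =>
      intro k h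
      -- Differentiating trades one factor `y` for one factor `D y`. The extra factor `D y` turns
      -- the term with `D (D y)` into a multiple of the element already in `J`, so two factors `D y`
      -- are paid for each `y`.
      have h1 := J.mul_mem_right (D y) (hD _ h)
      have h2 : D (y ^ (m + 1) * D y ^ k) * D y = ((m + 1 : ℕ) : K) • (y ^ m * D y ^ (k + 2)) +
          (y ^ (m + 1) * D y ^ k) * (k • D (D y)) := by
        rw [D.leibniz, D.leibniz_pow, D.leibniz_pow, Nat.cast_smul_eq_nsmul]
        -- `leibniz_pow` produces the exponent `k - 1`, which truncates at `k = 0`.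
        rcases k with _ | k
        · simp only [smul_eq_mul, nsmul_eq_mul, Nat.add_sub_cancel]
          push_cast; ring
        · simp only [smul_eq_mul, nsmul_eq_mul, Nat.add_sub_cancel]
          push_cast; ring
      rw [h2] at h1
      have h3 := (J.add_mem_iff_left (J.mul_mem_right _ h)).1 h1
      have h4 := Submodule.smul_of_tower_mem J ((m + 1 : ℕ) : K)⁻¹ h3
      rw [inv_smul_smul₀ (Nat.cast_ne_zero.2 m.succ_ne_zero)] at h4
      have h5 := ih (k + 2) h4
      rwa [show k + 2 * (m + 1) = k + 2 + 2 * m by ring]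
  obtain ⟨n, hn⟩ := hy
  exact ⟨_, key n 0 (by simpa using hn)⟩

/-- A derivation that is the identity on `m ⧸ (m² + J)` is
multiplication by `k` on `m ^ k ⧸ (m ^ (k + 1) + J)`. -/
theorem Ideal.euler_sub_mem {A : Type*} [CommRing A] (E : A →+ A)
    (hE : ∀ a b, E (a * b) = a * E b + b * E a) (m J : Ideal A)
    (h : ∀ z ∈ m, E z - z ∈ m ^ 2 ⊔ J) (k : ℕ) :
    ∀ u ∈ m ^ (k + 1), E u - (k + 1 : ℕ) * u ∈ m ^ (k + 1 + 1) ⊔ J := by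
  have key : ∀ {k l : ℕ} {a b : A}, a ∈ m ^ k → b ∈ m ^ l ⊔ J → a * b ∈ m ^ (k + l) ⊔ J := by
    intro k l a b ha hb
    obtain ⟨v, hv, w, hw, rfl⟩ := Submodule.mem_sup.1 hb
    rw [mul_add, pow_add]
    exact Submodule.add_mem_sup (Ideal.mul_mem_mul ha hv) (J.mul_mem_left _ hw)
  induction k with
  | zero => simpa using h
  | succ k ih =>
    intro u hu
    rw [pow_succ] at hu
    refine Submodule.mul_induction_on hu (fun a ha z hz => ?_) fun x y hx hy => ?_
    -- For a product `a * z` the errors `a (E z - z)` and `z (E a - (k+1) a)` add up to `E (a z) -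
    -- (k+2) a z`.
    · have h1 := key ha (h z hz)
      have h2 := key (k := 1) (by rwa [pow_one]) (ih a ha)
      rw [show 1 + (k + 1 + 1) = k + 1 + 2 by ring] at h2
      have h3 := add_mem h1 h2
      convert h3 using 1
      rw [hE]
      push_cast
      ring
    · have h3 := add_mem hx hy
      convert h3 using 1
      rw [map_add]
      ring

/-! ### Invariant derivations, bi-ideals and Cartier's theorem for them. -/

namespace CoordRing
variable {K G : Type*} [Field K] [Group G] [AffineAlgebraicGroup K G]

instance : Algebra.FiniteType K (CoordRing K G) :=
  ⟨(AffineAlgebraicGroup.regular (K := K) (G := G)).fg_top.2 AffineAlgebraicGroup.fg⟩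

instance : IsNoetherianRing (CoordRing K G) := Algebra.FiniteType.isNoetherianRing K _

/-- Left translation `f ↦ f (x * ·)`. -/
noncomputable def leftTranslate (x : G) : CoordRing K G →ₐ[K] CoordRing K G where
  toFun f := mk K (fun y => f (x * y)) (AffineAlgebraicGroup.regular_mul_left f.1 f.2 x)
  map_one' := rfl
  map_mul' _ _ := rfl
  map_zero' := rfl
  map_add' _ _ := rfl
  commutes' _ := rfl

@[simp] theorem leftTranslate_apply (x y : G) (f : CoordRing K G) :
    leftTranslate x f y = f (x * y) := rfl

/-- The slice `f ↦ (id ⊗ d)(Δ f)` of the comultiplication. -/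
noncomputable def slice (d : CoordRing K G →ₗ[K] K) : CoordRing K G →ₗ[K] CoordRing K G :=
  (TensorProduct.rid K _).toLinearMap ∘ₗ d.lTensor _ ∘ₗ Coalgebra.comul

/-- The functional `ev_x ⊗ d` on `Δ f` can be computed one tensor factor at a time, in either order.
This turns slices into pointwise expressions, so that identities about them reduce to identities
about `d`. -/
theorem slice_apply (d : CoordRing K G →ₗ[K] K) (f : CoordRing K G) (x : G) :
    slice d f x = d (leftTranslate x f) := by
  have h1 : ∀ t : CoordRing K G ⊗[K] CoordRing K G,
      TensorProduct.rid K _ (d.lTensor _ t) x =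
        d (TensorProduct.lid K _ ((eval K x).toLinearMap.rTensor _ t)) := by
    intro t
    induction t with
    | zero => simp
    | add s t hs ht => simp only [map_add, add_apply, hs, ht]
    | tmul a b => simp [mul_comm]
  have h2 : ∀ (y : G) (t : CoordRing K G ⊗[K] CoordRing K G),
      TensorProduct.lid K _ ((eval K x).toLinearMap.rTensor _ t) y = eval₂ K x y t := by
    intro y t
    induction t with
    | zero => simp
    | add s t hs ht => simp only [map_add, add_apply, hs, ht]
    | tmul a b => simp
  refine (h1 _).trans (congrArg d (ext_eval fun y => ?_))
  exact (h2 y _).trans (eval₂_comulHom f x y)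

/-- Right translation `f ↦ f (· * x)`. -/
noncomputable def rightTranslate (x : G) : CoordRing K G →ₐ[K] CoordRing K G :=
  -- Presenting right translation as a slice makes the stability of a bi-ideal under translation by
  -- its zeros an instance of `slice_mem`.
  AlgHom.ofLinearMap (slice (eval K x).toLinearMap)
    (ext_eval fun y => by simp [slice_apply])
    fun f g => ext_eval fun y => by simp [slice_apply]

@[simp] theorem rightTranslate_apply (x y : G) (f : CoordRing K G) :
    rightTranslate x f y = f (y * x) := slice_apply _ f y

/-- The left invariant derivation attached to a point derivation at `1`. -/
noncomputable def invariantDerivation (d : CoordRing K G →ₗ[K] K)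
    (hd : ∀ a b, d (a * b) = a 1 * d b + b 1 * d a) :
    Derivation K (CoordRing K G) (CoordRing K G) :=
  Derivation.mk' (slice d) fun a b => ext_eval fun x => by simp [slice_apply, hd]

/-- An ideal `J` of `𝒪(G)` is a bi-ideal: it vanishes at `1` and `(id ⊗ d)(Δ J) ⊆ J` for every
functional `d` that kills `J`. -/
structure IsBiideal (J : Ideal (CoordRing K G)) : Prop where
  eval_one : ∀ f ∈ J, f 1 = 0
  slice_mem : ∀ d : CoordRing K G →ₗ[K] K, (∀ f ∈ J, d f = 0) → ∀ f ∈ J, slice d f ∈ J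

namespace IsBiideal
variable {J : Ideal (CoordRing K G)} (hJ : IsBiideal J)
include hJ

theorem rightTranslate_mem {x : G} (hx : ∀ f ∈ J, f x = 0) {f : CoordRing K G} (hf : f ∈ J) :
    rightTranslate x f ∈ J := hJ.slice_mem _ hx f hf

/-- Stability under the antipode is not assumed, so inverses come from the Noetherian property. Let
`R_x` be right translation. The ideals `{f | R_{xⁿ} f ∈ J}` increase because `R_x J ⊆ J`. Once the
chain is constant at `n`, the element `R_{x⁻⁽ⁿ⁺¹⁾} f`, which lies in step `n + 1`, lies in step `n`,
and this says `R_{x⁻¹} f ∈ J`. -/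
theorem rightTranslate_inv_mem {x : G} (hx : ∀ f ∈ J, f x = 0) {f : CoordRing K G} (hf : f ∈ J) :
    rightTranslate x⁻¹ f ∈ J := by
  let c : ℕ →o Ideal (CoordRing K G) :=
    { toFun := fun n => J.comap (rightTranslate (K := K) (x ^ n))
      monotone' := monotone_nat_of_le_succ fun n f hf => by
        rw [Ideal.mem_comap] at hf ⊢
        have := hJ.rightTranslate_mem hx hf
        convert this using 1
        exact ext_eval fun y => by simp [pow_succ', mul_assoc] }
  obtain ⟨n, hn⟩ := monotone_stabilizes_iff_noetherian.2
    (inferInstanceAs (IsNoetherianRing (CoordRing K G))) c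
  have h1 : rightTranslate (x ^ (n + 1))⁻¹ f ∈ c (n + 1) := by
    change rightTranslate (x ^ (n + 1)) _ ∈ J
    convert hf using 1
    exact ext_eval fun y => by simp
  rw [← hn (n + 1) n.le_succ] at h1
  change rightTranslate (x ^ n) _ ∈ J at h1
  convert h1 using 1
  refine ext_eval fun y => ?_
  simp only [eval_apply, rightTranslate_apply]
  congr 1
  rw [pow_succ']
  group

/-- The algebraic subgroup defined by a bi-ideal. -/
noncomputable def zeroSubgroup : AlgebraicSubgroup K G where
  carrier := {x | ∀ f ∈ J, f x = 0}
  mul_mem' {x y} hx hy f hf := by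
    have := hx _ (hJ.rightTranslate_mem hy hf)
    simpa using this
  one_mem' := hJ.eval_one
  inv_mem' {x} hx f hf := by
    have := hJ.eval_one _ (hJ.rightTranslate_inv_mem hx hf)
    simpa using this
  isZariskiClosed := ⟨J, rfl⟩

end IsBiideal

/-- When `J` vanishes at `1`, the space `𝒪(G)/(m² + J + K·1)` is the cotangent space at the identity
of the scheme cut out by `J`. It is spanned by the classes of algebra generators, hence
finite-dimensional. The `d i` are the coordinates of a basis and the `x i` are lifts of that basis.
Dividing by the constants as well makes the `d i` point derivations on all of `𝒪(G)`. -/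
theorem exists_euler (J : Ideal (CoordRing K G)) :
    ∃ (n : ℕ) (x : Fin n → CoordRing K G) (d : Fin n → CoordRing K G →ₗ[K] K),
      (∀ i, x i 1 = 0) ∧ (∀ i a b, d i (a * b) = a 1 * d i b + b 1 * d i a) ∧
      (∀ i, ∀ f ∈ J, d i f = 0) ∧ ∀ z : CoordRing K G, z 1 = 0 → (∀ f ∈ J, f 1 = 0) →
        z - ∑ i, d i z • x i ∈ RingHom.ker (eval K (1 : G)) ^ 2 ⊔ J := by
  let m : Ideal (CoordRing K G) := RingHom.ker (eval K (1 : G))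
  let W : Submodule K (CoordRing K G) := (m ^ 2 ⊔ J).restrictScalars K ⊔ K ∙ (1 : CoordRing K G)
  have hW1 : (1 : CoordRing K G) ∈ W :=
    Submodule.mem_sup_right (Submodule.mem_span_singleton_self _)
  have hWc : ∀ r : K, algebraMap K (CoordRing K G) r ∈ W := fun r => by
    rw [Algebra.algebraMap_eq_smul_one]; exact W.smul_mem r hW1
  have hW2 : ∀ a b : CoordRing K G, a 1 = 0 → b 1 = 0 → a * b ∈ W := fun a b ha hb => by
    refine Submodule.mem_sup_left (Submodule.mem_sup_left ?_ : a * b ∈ m ^ 2 ⊔ J)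
    rw [pow_two]
    exact Ideal.mul_mem_mul ha hb
  have hfin : Module.Finite K (CoordRing K G ⧸ W) := by
    obtain ⟨s, hs⟩ := (inferInstance : Algebra.FiniteType K (CoordRing K G)).out
    classical
    refine ⟨⟨s.image W.mkQ, ?_⟩⟩
    rw [eq_top_iff]
    intro q _
    obtain ⟨a, rfl⟩ := W.mkQ_surjective q
    have ha : a ∈ Algebra.adjoin K (s : Set (CoordRing K G)) := by rw [hs]; trivial
    induction ha using Algebra.adjoin_induction with
    | mem a ha => exact Submodule.subset_span (by simpa using ⟨a, ha, rfl⟩)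
    | algebraMap r =>
      have : W.mkQ (algebraMap K _ r) = 0 := by simpa using hWc r
      rw [this]; exact zero_mem _
    | add a b _ _ ha hb => rw [map_add]; exact add_mem (ha trivial) (hb trivial)
    | mul a b _ _ ha hb =>
      -- Modulo `m²` and constants the product is linear in each factor, so the span of the
      -- generators is closed under products.
      have h1 : a * b = (a - algebraMap K _ (a 1)) * (b - algebraMap K _ (b 1)) + a 1 • b + b 1 • a
          - algebraMap K _ (a 1 * b 1) := ext_eval fun x => by simp; ring
      have h2 : W.mkQ (a * b) = a 1 • W.mkQ b + b 1 • W.mkQ a := by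
        conv_lhs => rw [h1]
        rw [map_sub, map_add, map_add, map_smul, map_smul]
        have h3 : W.mkQ ((a - algebraMap K _ (a 1)) * (b - algebraMap K _ (b 1))) = 0 := by
          simpa using hW2 (a - algebraMap K _ (a 1)) (b - algebraMap K _ (b 1)) (by simp) (by simp)
        have h4 : W.mkQ (algebraMap K _ (a 1 * b 1)) = 0 := by simpa using hWc (a 1 * b 1)
        rw [h3, h4, zero_add, sub_zero]
      rw [h2]
      exact add_mem (Submodule.smul_mem _ _ (hb trivial)) (Submodule.smul_mem _ _ (ha trivial))
  let b := Module.finBasis K (CoordRing K G ⧸ W)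
  choose x hx using fun i => W.mkQ_surjective (b i)
  have hd0 : ∀ i, ∀ f ∈ W, b.coord i (W.mkQ f) = 0 := fun i f hf => by
    have : W.mkQ f = 0 := by simpa using hf
    rw [this, map_zero]
  refine ⟨_, fun i => x i - algebraMap K _ (x i 1), fun i => b.coord i ∘ₗ W.mkQ,
    fun i => by simp, fun i u v => ?_, fun i f hf =>
      hd0 i f (Submodule.mem_sup_left (Submodule.mem_sup_right hf : f ∈ m ^ 2 ⊔ J)),
    fun z hz hJ1 => ?_⟩
  · have h1 : u * v = (u - algebraMap K _ (u 1)) * (v - algebraMap K _ (v 1)) + u 1 • v + v 1 • u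
        - algebraMap K _ (u 1 * v 1) := ext_eval fun x => by simp; ring
    have h2 := hd0 i _ (hW2 (u - algebraMap K _ (u 1)) (v - algebraMap K _ (v 1))
      (by simp) (by simp))
    have h3 := hd0 i _ (hWc (u 1 * v 1))
    rw [LinearMap.comp_apply]
    conv_lhs => rw [h1]
    simp only [map_sub, map_add, map_smul, h2, h3, LinearMap.comp_apply, smul_eq_mul]
    ring
  · set u : CoordRing K G := z - ∑ i, (b.coord i ∘ₗ W.mkQ) z • (x i - algebraMap K _ (x i 1))
      with hu
    have hu1 : u 1 = 0 := by simp [hu, hz]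
    have huW : u ∈ W := by
      have : W.mkQ u = 0 := by
        have h1 : ∀ i, W.mkQ (x i - algebraMap K _ (x i 1)) = b i := fun i => by
          rw [map_sub, hx]
          have : W.mkQ (algebraMap K _ (x i 1)) = 0 := by simpa using hWc (x i 1)
          rw [this, sub_zero]
        rw [hu, map_sub, map_sum]
        simp only [map_smul, h1]
        exact sub_eq_zero.2 (b.sum_repr _).symm
      simpa using this
    obtain ⟨v, hv, w, hw, hvw⟩ := Submodule.mem_sup.1 huW
    obtain ⟨r, rfl⟩ := Submodule.mem_span_singleton.1 hw
    -- Evaluation at `1` removes the constant summand; this is where `J ⊆ m` is needed.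
    have hv1 : v 1 = 0 := by
      have : m ^ 2 ⊔ J ≤ m := sup_le (Ideal.pow_le_self two_ne_zero) hJ1
      exact this hv
    have hr : r = 0 := by
      have := congrArg (fun f : CoordRing K G => f 1) hvw
      simpa [hv1, hu1] using this
    rw [← hvw, hr, zero_smul, add_zero]
    exact hv
-- The residue field is finite over `K` by Zariski's lemma, hence equal to `K`, and characters of
-- `𝒪(G)` are points.
theorem exists_point_of_isMaximal [IsAlgClosed K] (M : Ideal (CoordRing K G)) [hM : M.IsMaximal] :
    ∃ x : G, M = RingHom.ker (eval K x) := by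
  let _ := Ideal.Quotient.field M
  have : Module.Finite K (CoordRing K G ⧸ M) := finite_of_finite_type_of_isJacobsonRing K _
  have hbij := IsAlgClosed.algebraMap_bijective_of_isIntegral (k := K) (K := CoordRing K G ⧸ M)
  let e : K ≃ₐ[K] (CoordRing K G ⧸ M) := AlgEquiv.ofBijective (Algebra.ofId K _) hbij
  obtain ⟨x, hx⟩ := AffineAlgebraicGroup.exists_point (K := K) (G := G)
    (e.symm.toAlgHom.comp (Ideal.Quotient.mkₐ K M))
  refine ⟨x, hM.eq_of_le (RingHom.ker_ne_top _) fun f hf => ?_⟩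
  have h1 : Ideal.Quotient.mkₐ K M f = 0 := Ideal.Quotient.eq_zero_iff_mem.2 hf
  have h2 := hx f
  exact h2.symm.trans ((congrArg e.symm h1).trans (map_zero e.symm))

namespace IsBiideal
variable {J : Ideal (CoordRing K G)} (hJ : IsBiideal J)
include hJ

/-- This is the core of Cartier's theorem. The left invariant derivations `D i` extending the `d i`
preserve `J`, hence also its radical. The Euler field `E = ∑ x_i D_i` therefore sends `y ∈ √J` one
step deeper: if `√J ⊆ m^k + J`, then `E y ∈ m^(k+1) + J`. But `E` acts as multiplication by `k` on
`m^k` modulo `m^(k+1) + J`, and `k` is invertible for `k ≥ 1`. -/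
theorem radical_le_pow_sup [CharZero K] (k : ℕ) :
    J.radical ≤ RingHom.ker (eval K (1 : G)) ^ k ⊔ J := by
  obtain ⟨n, x, d, hx, hd, hdJ, hz⟩ := exists_euler J
  let m : Ideal (CoordRing K G) := RingHom.ker (eval K (1 : G))
  let D : Fin n → Derivation K (CoordRing K G) (CoordRing K G) :=
    fun i => invariantDerivation (d i) (hd i)
  have hD1 : ∀ i f, D i f 1 = d i f := fun i f => by
    refine (slice_apply (d i) f 1).trans (congrArg (d i) (ext_eval fun y => ?_))
    simp
  have hDJ : ∀ i, ∀ f ∈ J, D i f ∈ J := fun i => hJ.slice_mem (d i) (hdJ i)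
  let E : Derivation K (CoordRing K G) (CoordRing K G) := ∑ i, x i • D i
  have hE : ∀ f, E f = ∑ i, x i * D i f := fun f => by
    refine (congrFun (map_sum Derivation.coeFnAddMonoidHom (fun i => x i • D i) _) f).trans ?_
    simp [Finset.sum_apply]
  have hEJ : ∀ f ∈ J, E f ∈ J := fun f hf => by
    rw [hE]; exact Ideal.sum_mem _ fun i _ => J.mul_mem_left _ (hDJ i f hf)
  have hEm : ∀ z ∈ m, E z - z ∈ m ^ 2 ⊔ J := by
    intro z hzm
    have h1 := hz z hzm hJ.eval_one
    have h2 : E z - ∑ i, d i z • x i ∈ m ^ 2 ⊔ J := by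
      rw [hE, ← Finset.sum_sub_distrib]
      refine Ideal.sum_mem _ fun i _ => Submodule.mem_sup_left ?_
      -- `D i z` has value `d i z` at `1`, so both factors vanish at `1`.
      have : x i * D i z - d i z • x i = x i * (D i z - algebraMap K _ (d i z)) :=
        ext_eval fun y => by simp; ring
      rw [this, pow_two]
      exact Ideal.mul_mem_mul (hx i) (by change (D i z - algebraMap K _ (d i z)) 1 = 0; simp [hD1])
    have := sub_mem h2 h1
    convert this using 1
    ring
  induction k with
  | zero => simp
  | succ k ih =>
    rcases k with _ | k
    -- Exponent `1` is separate, since the Euler factor there would be `0`; it holds because `J`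
    -- vanishes at `1` and `K` is reduced.
    · rw [zero_add, pow_one]
      rintro y ⟨n, hn⟩
      refine Submodule.mem_sup_left ?_
      have := hJ.eval_one _ hn
      exact eq_zero_of_pow_eq_zero ((map_pow (eval K (1 : G)) y n).symm.trans this)
    intro y hy
    obtain ⟨u, hu, v, hv, rfl⟩ := Submodule.mem_sup.1 (ih hy)
    have h1 : E (u + v) ∈ m ^ (k + 1 + 1) ⊔ J := by
      rw [hE]
      refine Ideal.sum_mem _ fun i _ => ?_
      obtain ⟨p, hp, q, hq, hpq⟩ :=
        Submodule.mem_sup.1 (ih ((D i).mem_radical J (hDJ i) hy))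
      rw [← hpq, mul_add, pow_succ']
      exact Submodule.add_mem_sup (Ideal.mul_mem_mul (hx i) hp) (J.mul_mem_left _ hq)
    have h2 := Ideal.euler_sub_mem E.toLinearMap.toAddMonoidHom (fun a b => E.leibniz a b) m J hEm
      k u hu
    have h3 : E v ∈ m ^ (k + 1 + 1) ⊔ J := Submodule.mem_sup_right (hEJ v hv)
    have h4 : ((k + 1 : ℕ) : K) • u ∈ m ^ (k + 1 + 1) ⊔ J := by
      have := sub_mem (sub_mem h1 h3) h2
      convert this using 1
      rw [map_add, Nat.cast_smul_eq_nsmul, nsmul_eq_mul]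
      change _ = E u + E v - E v - (E u - _)
      ring
    have h5 := Submodule.smul_of_tower_mem _ ((k + 1 : ℕ) : K)⁻¹ h4
    rw [inv_smul_smul₀ (Nat.cast_ne_zero.2 k.succ_ne_zero)] at h5
    exact add_mem h5 (Submodule.mem_sup_right hv)

/-- Right translation by `x ∈ H` and by its inverse preserve `J`, so the estimate at `1` can be
carried to every zero of `J`. -/
theorem radical_le_ker_pow_sup [CharZero K] {x : G} (hx : x ∈ hJ.zeroSubgroup.toSubgroup) (k : ℕ) :
    J.radical ≤ RingHom.ker (eval K x) ^ k ⊔ J := by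
  rintro y ⟨n, hn⟩
  have h1 : rightTranslate x y ∈ J.radical :=
    ⟨n, by rw [← map_pow]; exact hJ.rightTranslate_mem hx hn⟩
  obtain ⟨u, hu, v, hv, huv⟩ := Submodule.mem_sup.1 (hJ.radical_le_pow_sup k h1)
  have h2 : y = rightTranslate x⁻¹ u + rightTranslate x⁻¹ v := by
    rw [← map_add, huv]; exact ext_eval fun z => by simp
  rw [h2]
  refine Submodule.add_mem_sup ?_ (hJ.rightTranslate_inv_mem hx hv)
  have h3 := Ideal.mem_map_of_mem (rightTranslate (K := K) x⁻¹) hu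
  rw [Ideal.map_pow] at h3
  refine Ideal.pow_right_mono (Ideal.map_le_iff_le_comap.2 fun f hf => ?_) k h3
  change rightTranslate x⁻¹ f x = 0
  rw [rightTranslate_apply, mul_inv_cancel]
  exact hf

/-- Bi-ideals are radical in characteristic zero (Cartier). -/
theorem radical_eq [CharZero K] [IsAlgClosed K] : J.radical = J := by
  refine le_antisymm (fun y hy => ?_) Ideal.le_radical
  by_contra hyJ
  -- The failure `y ∉ J` is localised at a point: a maximal ideal over `(J : y)` also contains `J`,
  -- so it belongs to a zero `x` of `J`.
  have hI : J.colon {y} ≠ ⊤ := fun h => hyJ (by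
    have : (1 : CoordRing K G) ∈ J.colon {y} := by rw [h]; trivial
    simpa [Submodule.mem_colon_singleton] using this)
  obtain ⟨M, hM, hle⟩ := Ideal.exists_le_maximal _ hI
  obtain ⟨x, rfl⟩ := exists_point_of_isMaximal M
  have hx : x ∈ hJ.zeroSubgroup.toSubgroup := fun f hf =>
    hle (Submodule.mem_colon_singleton.2 (J.mul_mem_right _ hf))
  have hmem : (Ideal.Quotient.mk J y : CoordRing K G ⧸ J) ∈
      ⨅ i, RingHom.ker (eval K x) ^ i • (⊤ : Submodule (CoordRing K G) (CoordRing K G ⧸ J)) := by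
    rw [Submodule.mem_iInf]
    intro k
    obtain ⟨u, hu, v, hv, rfl⟩ := Submodule.mem_sup.1 (hJ.radical_le_ker_pow_sup hx k hy)
    rw [map_add, Ideal.Quotient.eq_zero_iff_mem.2 hv, add_zero]
    have := Submodule.smul_mem_smul hu
      (Submodule.mem_top (R := CoordRing K G) (x := (1 : CoordRing K G ⧸ J)))
    rwa [Algebra.smul_def, mul_one] at this
  -- By Krull's intersection theorem `r y ≡ y` modulo `J` for some `r` vanishing at `x`. Then `1 - r
  -- ∈ (J : y)` vanishes at `x` too, which is absurd.
  obtain ⟨r, hr⟩ := (Ideal.mem_iInf_smul_pow_eq_bot_iff _ _).1 hmem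
  rw [Algebra.smul_def, Ideal.Quotient.algebraMap_eq, ← map_mul, Ideal.Quotient.eq] at hr
  have h1 : (1 - r.1) ∈ RingHom.ker (eval K x) := by
    refine hle (Submodule.mem_colon_singleton.2 ?_)
    have := J.neg_mem hr
    convert this using 1
    simp only [smul_eq_mul]
    ring
  exact (Ideal.ne_top_iff_one _).1 hM.ne_top (by simpa using add_mem h1 r.2)

/-- A bi-ideal is the ideal of an algebraic subgroup. -/
theorem mem_iff_vanish [CharZero K] [IsAlgClosed K] (f : CoordRing K G) :
    f ∈ J ↔ ∀ x ∈ hJ.zeroSubgroup.toSubgroup, f x = 0 := by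
  refine ⟨fun hf x hx => hx f hf, fun h => ?_⟩
  -- The Nullstellensatz: a radical ideal is the intersection of the maximal ideals over it, which
  -- are points.
  have hjac : IsJacobsonRing (CoordRing K G) := isJacobsonRing_of_finiteType (A := K)
  rw [← hJ.radical_eq, Ideal.radical_eq_jacobson, Ideal.jacobson, Ideal.mem_sInf]
  rintro M ⟨hle, hM⟩
  obtain ⟨x, rfl⟩ := exists_point_of_isMaximal M
  exact h x hle

end IsBiideal

/-- A functional that kills `J` factors as `d' ∘ q`, and `q` carries `(id ⊗ d)(Δ f)` to `(id ⊗ d')(Δ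
(q f))`. Multiplicativity of `q` plays no role, which matters because `a ↦ f (j a)` is not
multiplicative for the untwisted product in general. -/
theorem isBiideal_of_coalgHom {C : Type*} [AddCommGroup C] [Module K C] [Coalgebra K C]
    (q : CoordRing K G →ₗc[K] C) (hq : Function.Surjective q) (J : Ideal (CoordRing K G))
    (hJ : ∀ f, f ∈ J ↔ q f = 0) : IsBiideal J where
  eval_one f hf := by
    have h := CoalgHomClass.counit_comp_apply q f
    rw [(hJ f).1 hf, map_zero] at h
    exact h.symm
  slice_mem d hd f hf := by
    obtain ⟨s, hs⟩ := (q : CoordRing K G →ₗ[K] C).exists_rightInverse_of_surjective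
      (LinearMap.range_eq_top.2 hq)
    have hd' : ∀ a, d (s (q a)) = d a := fun a => by
      rw [← sub_eq_zero, ← map_sub]
      refine hd _ ((hJ _).2 ?_)
      rw [map_sub, sub_eq_zero]
      exact LinearMap.congr_fun hs (q a)
    have h : ∀ t : CoordRing K G ⊗[K] CoordRing K G,
        q (TensorProduct.rid K _ (d.lTensor _ t)) = TensorProduct.rid K _ ((d ∘ₗ s).lTensor _
          (TensorProduct.map (q : CoordRing K G →ₗ[K] C) (q : CoordRing K G →ₗ[K] C) t)) := by
      intro t
      induction t with
      | zero => simp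
      | add s t hs ht => simp only [map_add, hs, ht]
      | tmul a b => simp [hd']
    rw [hJ] at hf ⊢
    refine (h _).trans ?_
    rw [CoalgHomClass.map_comp_comul_apply, hf]
    simp
end CoordRing

/-! ### Quotients of bialgebras and Hopf algebras -/

namespace BialgHom
variable {K A L M : Type*} [Field K] [Ring A] [Bialgebra K A] [Ring L] [Bialgebra K L]
  [Ring M] [Bialgebra K M]

theorem exists_lift (q : A →ₐc[K] L) (r : A →ₐc[K] M) (hq : Function.Surjective q)
    (h : ∀ a, q a = 0 → r a = 0) : ∃ g : L →ₐc[K] M, ∀ a, g (q a) = r a := by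
  have key : ∀ a b, q a = q b → r a = r b := fun a b hab => by
    rw [← sub_eq_zero, ← map_sub]
    exact h _ (by rw [map_sub, hab, sub_self])
  have hs := Function.surjInv_eq hq
  let g : L →ₐ[K] M :=
    { toFun := fun x => r (Function.surjInv hq x)
      map_one' := (key _ 1 (by rw [hs, map_one])).trans (map_one r)
      map_mul' := fun x y => by rw [← map_mul]; exact key _ _ (by rw [hs, map_mul, hs, hs])
      map_zero' := (key _ 0 (by rw [hs, map_zero])).trans (map_zero r)
      map_add' := fun x y => by rw [← map_add]; exact key _ _ (by rw [hs, map_add, hs, hs])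
      commutes' := fun k =>
        (key _ (algebraMap K A k) (by rw [hs]; exact ((q : A →ₐ[K] L).commutes k).symm)).trans
          ((r : A →ₐ[K] M).commutes k) }
  have hg : ∀ a, g (q a) = r a := fun a => key _ _ (hs _)
  refine ⟨BialgHom.ofAlgHom g (AlgHom.ext fun x => ?_) (AlgHom.ext fun x => ?_), hg⟩
  · obtain ⟨a, rfl⟩ := hq x
    change Coalgebra.counit (R := K) (g (q a)) = Coalgebra.counit (R := K) (q a)
    rw [hg, CoalgHomClass.counit_comp_apply, CoalgHomClass.counit_comp_apply]
  · obtain ⟨a, rfl⟩ := hq x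
    change TensorProduct.map g.toLinearMap g.toLinearMap (Coalgebra.comul (R := K) (q a)) =
      Coalgebra.comul (R := K) (g (q a))
    rw [hg, ← CoalgHomClass.map_comp_comul_apply q, ← CoalgHomClass.map_comp_comul_apply r,
      ← LinearMap.comp_apply, ← TensorProduct.map_comp]
    have : g.toLinearMap ∘ₗ (q : A →ₗ[K] L) = (r : A →ₗ[K] M) := LinearMap.ext hg
    rw [this]

theorem nonempty_equiv_of_ker_eq (q : A →ₐc[K] L) (r : A →ₐc[K] M) (hq : Function.Surjective q)
    (hr : Function.Surjective r) (h : ∀ a, q a = 0 ↔ r a = 0) : Nonempty (L ≃ₐc[K] M) := by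
  obtain ⟨g, hg⟩ := exists_lift q r hq fun a => (h a).1
  obtain ⟨g', hg'⟩ := exists_lift r q hr fun a => (h a).2
  refine ⟨BialgEquiv.ofBialgHom g g' (BialgHom.ext fun x => ?_) (BialgHom.ext fun x => ?_)⟩
  · obtain ⟨a, rfl⟩ := hr x
    change g (g' (r a)) = r a
    rw [hg', hg]
  · obtain ⟨a, rfl⟩ := hq x
    change g' (g (q a)) = q a
    rw [hg, hg']

end BialgHom

/-- In the convolution algebra of linear maps from `A` to `L`, `f ∘ S` is a left inverse of `f` and
`S ∘ f` is a right inverse, so they agree. -/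
theorem BialgHom.map_antipode {K A L : Type*} [Field K] [Ring A] [HopfAlgebra K A] [Ring L]
    [HopfAlgebra K L] (f : A →ₐc[K] L) (a : A) :
    f (HopfAlgebra.antipode K a) = HopfAlgebra.antipode K (f a) := by
  have h1 : WithConv.toConv ((f : A →ₐ[K] L).toLinearMap ∘ₗ HopfAlgebra.antipode K) *
      WithConv.toConv (f : A →ₐ[K] L).toLinearMap = 1 := by
    have h := LinearMap.algHom_comp_convMul_distrib (f : A →ₐ[K] L)
      (WithConv.toConv (HopfAlgebra.antipode K (A := A))) (WithConv.toConv LinearMap.id)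
    rw [LinearMap.antipode_mul_id] at h
    refine WithConv.ext (Eq.trans h.symm (LinearMap.ext fun a => ?_))
    exact (f : A →ₐ[K] L).commutes _
  have h2 : WithConv.toConv (f : A →ₐ[K] L).toLinearMap *
      WithConv.toConv (HopfAlgebra.antipode K ∘ₗ (f : A →ₐ[K] L).toLinearMap) = 1 := by
    have h := LinearMap.convMul_comp_coalgHom_distrib
      (WithConv.toConv (LinearMap.id (R := K) (M := L)))
      (WithConv.toConv (HopfAlgebra.antipode K (A := L))) (f : A →ₗc[K] L)
    rw [LinearMap.id_mul_antipode] at h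
    refine WithConv.ext (Eq.trans h.symm (LinearMap.ext fun a => ?_))
    exact congrArg (algebraMap K L) (CoalgHomClass.counit_comp_apply f a)
  exact LinearMap.congr_fun (congrArg WithConv.ofConv (left_inv_eq_right_inv h1 h2)) a

/-! ### Subcoalgebras -/

namespace Submodule
variable {K C : Type*} [Field K] [AddCommGroup C] [Module K C]

theorem range_mapIncl_mono {V V' W W' : Submodule K C} (hV : V ≤ V') (hW : W ≤ W') :
    LinearMap.range (TensorProduct.mapIncl V W) ≤ LinearMap.range (TensorProduct.mapIncl V' W') := by
  rintro _ ⟨t, rfl⟩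
  refine ⟨TensorProduct.map (inclusion hV) (inclusion hW) t, ?_⟩
  rw [TensorProduct.mapIncl, ← LinearMap.comp_apply, ← TensorProduct.map_comp]
  rfl

/-- Linear projections onto `V` and `W` exist over a field. The tensor is fixed by the projection to
`V` in the first factor and by the projection to `W` in the second, hence by their composite. -/
theorem mem_range_mapIncl_of_mem {V W : Submodule K C} {t : C ⊗[K] C}
    (hV : t ∈ LinearMap.range (TensorProduct.mapIncl V V))
    (hW : t ∈ LinearMap.range (TensorProduct.mapIncl W W)) :
    t ∈ LinearMap.range (TensorProduct.mapIncl V W) := by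
  obtain ⟨p, hp⟩ := V.subtype.exists_leftInverse_of_injective V.ker_subtype
  obtain ⟨q, hq⟩ := W.subtype.exists_leftInverse_of_injective W.ker_subtype
  have h1 : (V.subtype ∘ₗ p).rTensor C t = t := by
    obtain ⟨s, rfl⟩ := hV
    rw [TensorProduct.mapIncl, ← LinearMap.comp_apply, LinearMap.rTensor, ← TensorProduct.map_comp,
      LinearMap.comp_assoc, hp]
    rfl
  have h2 : (W.subtype ∘ₗ q).lTensor C t = t := by
    obtain ⟨s, rfl⟩ := hW
    rw [TensorProduct.mapIncl, ← LinearMap.comp_apply, LinearMap.lTensor, ← TensorProduct.map_comp,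
      LinearMap.comp_assoc W.subtype, hq]
    rfl
  refine ⟨TensorProduct.map p q t, ?_⟩
  conv_rhs => rw [← h1, ← h2]
  rw [TensorProduct.mapIncl, ← LinearMap.comp_apply, ← LinearMap.comp_apply,
    ← TensorProduct.map_comp, LinearMap.rTensor_comp_lTensor]

variable [Coalgebra K C]

/-- A subspace `V` with `Δ V ⊆ V ⊗ V`. -/
def IsSubcoalgebra (V : Submodule K C) : Prop :=
  V ≤ (LinearMap.range (TensorProduct.mapIncl V V)).comap Coalgebra.comul

theorem IsSubcoalgebra.iSup {ι : Sort*} {V : ι → Submodule K C} (h : ∀ i, (V i).IsSubcoalgebra) :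
    (⨆ i, V i).IsSubcoalgebra :=
  iSup_le fun i => (h i).trans (comap_mono (range_mapIncl_mono (le_iSup V i) (le_iSup V i)))

/-- For `d ≠ 0` in the intersection and a functional `ψ` with `ψ d ≠ 0`, the element `(id ⊗ ψ)(Δ d)`
stays in both subcoalgebras and has counit `ψ d`. -/
theorem IsSubcoalgebra.exists_counit_eq_one {V W : Submodule K C} (hV : V.IsSubcoalgebra)
    (hW : W.IsSubcoalgebra) (h : ¬ Disjoint V W) :
    ∃ d ∈ V, d ∈ W ∧ Coalgebra.counit (R := K) d = 1 := by
  rw [disjoint_iff, Submodule.eq_bot_iff] at h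
  push Not at h
  obtain ⟨d, ⟨hdV, hdW⟩, hd⟩ := h
  obtain ⟨ψ, hψ⟩ : ∃ ψ : Module.Dual K C, ψ d ≠ 0 := by
    by_contra! hcon
    exact hd ((Module.forall_dual_apply_eq_zero_iff K d).1 hcon)
  have key : ∀ U : Submodule K C, U.IsSubcoalgebra → d ∈ U →
      TensorProduct.rid K C (ψ.lTensor C (Coalgebra.comul d)) ∈ U := by
    intro U hU hdU
    obtain ⟨s, hs⟩ := hU hdU
    rw [← hs]
    clear hs
    induction s with
    | zero => simp
    | add s t hs ht => simp only [map_add]; exact add_mem hs ht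
    | tmul a b => simpa [TensorProduct.mapIncl] using U.smul_mem _ a.2
  have h2 : Coalgebra.counit (R := K) (TensorProduct.rid K C (ψ.lTensor C (Coalgebra.comul d))) =
      ψ d := by
    have h3 : ∀ t : C ⊗[K] C, Coalgebra.counit (R := K) (TensorProduct.rid K C (ψ.lTensor C t)) =
        ψ (TensorProduct.lid K C ((Coalgebra.counit (R := K)).rTensor C t)) := by
      intro t
      induction t with
      | zero => simp
      | add s t hs ht => simp only [map_add, hs, ht]
      | tmul a b => simp [mul_comm]
    rw [h3, Coalgebra.rTensor_counit_comul]
    simp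
  exact ⟨(ψ d)⁻¹ • _, V.smul_mem _ (key V hV hdV), W.smul_mem _ (key W hW hdW), by
    rw [map_smul, h2, smul_eq_mul, inv_mul_cancel₀ hψ]⟩

end Submodule

namespace Submodule
variable {K L : Type*} [Field K] [Ring L]

/-- If `d ∈ V ∩ W` has counit `1`, then `Δ d ∈ V ⊗ W`, and the antipode axiom reads `1 = d₁ S(d₂)`.
-/
theorem IsSubcoalgebra.one_mem_mul_antipode [HopfAlgebra K L] {V W : Submodule K L}
    (hV : V.IsSubcoalgebra) (hW : W.IsSubcoalgebra) (h : ¬ Disjoint V W) :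
    (1 : L) ∈ V * W.map (HopfAlgebra.antipode K) := by
  obtain ⟨d, hdV, hdW, hd⟩ := hV.exists_counit_eq_one hW h
  have h1 := HopfAlgebra.mul_antipode_lTensor_comul_apply (R := K) d
  rw [hd, map_one] at h1
  rw [← h1]
  obtain ⟨s, hs⟩ := mem_range_mapIncl_of_mem (hV hdV) (hW hdW)
  rw [← hs]
  clear hs h1
  induction s with
  | zero => simp
  | add s t hs ht => simp only [map_add]; exact add_mem hs ht
  | tmul a b => simpa [TensorProduct.mapIncl] using mul_mem_mul a.2 (mem_map_of_mem b.2)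

variable [Bialgebra K L]

/-- Otherwise there are functionals `φ` killing `V` and `ψ` killing `W`, both nonzero at `1`. Their
convolution kills `V` through its first leg and `W` through its second, but takes the nonzero value
`φ(1) ψ(1)` at the group-like element `1`. -/
theorem IsSubcoalgebra.one_mem_or {V W : Submodule K L} (hV : V.IsSubcoalgebra)
    (hW : W.IsSubcoalgebra) (h : (1 : L) ∈ V ⊔ W) : (1 : L) ∈ V ∨ (1 : L) ∈ W := by
  by_contra! hcon
  obtain ⟨φ, hφ1, hφ⟩ := V.exists_le_ker_of_notMem hcon.1
  obtain ⟨ψ, hψ1, hψ⟩ := W.exists_le_ker_of_notMem hcon.2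
  let Φ : L →ₗ[K] K := LinearMap.mul' K K ∘ₗ TensorProduct.map φ ψ ∘ₗ Coalgebra.comul
  have h1 : V ⊔ W ≤ LinearMap.ker Φ := by
    refine sup_le (fun v hv => ?_) (fun v hv => ?_)
    · obtain ⟨s, hs⟩ := hV hv
      rw [LinearMap.mem_ker, LinearMap.comp_apply, LinearMap.comp_apply, ← hs]
      clear hs
      induction s with
      | zero => simp
      | add s t hs ht => simp only [map_add, hs, ht, add_zero]
      | tmul a b =>
        have : φ a = 0 := hφ a.2
        simp [TensorProduct.mapIncl, this]
    · obtain ⟨s, hs⟩ := hW hv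
      rw [LinearMap.mem_ker, LinearMap.comp_apply, LinearMap.comp_apply, ← hs]
      clear hs
      induction s with
      | zero => simp
      | add s t hs ht => simp only [map_add, hs, ht, add_zero]
      | tmul a b =>
        have : ψ b = 0 := hψ b.2
        simp [TensorProduct.mapIncl, this]
  have h2 : Φ 1 = 0 := h1 h
  have h3 : Φ 1 = φ 1 * ψ 1 := by
    simp only [Φ, LinearMap.comp_apply, Bialgebra.comul_one, Algebra.TensorProduct.one_def,
      TensorProduct.map_tmul, LinearMap.mul'_apply]
  exact mul_ne_zero hφ1 hψ1 (h3.symm.trans h2)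

theorem IsSubcoalgebra.exists_one_mem {ι : Type*} (s : Finset ι) {V : ι → Submodule K L}
    (hV : ∀ i, (V i).IsSubcoalgebra) (h : (1 : L) ∈ ⨆ i ∈ s, V i) : ∃ i ∈ s, (1 : L) ∈ V i := by
  classical
  induction s using Finset.induction_on with
  | empty =>
    have h1 : (1 : L) = 0 := by simpa using h
    have h2 := congrArg (Coalgebra.counit (R := K)) h1
    rw [Bialgebra.counit_one, map_zero] at h2
    exact absurd h2 one_ne_zero
  | insert i s _ ih =>
    rw [Finset.iSup_insert] at h
    rcases (hV i).one_mem_or (.iSup fun i => .iSup fun _ => hV i) h with h | h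
    · exact ⟨i, s.mem_insert_self i, h⟩
    · obtain ⟨k, hk, h⟩ := ih h
      exact ⟨k, Finset.mem_insert_of_mem hk, h⟩

end Submodule

/-! ### Quotients of graded twistings -/

namespace InvariantCocentralAction
open GradedTwist

section Functoriality
variable {K Γ A A' : Type*} [Field K] [Group Γ] [Ring A] [HopfAlgebra K A] [Ring A']
  [HopfAlgebra K A'] {c : InvariantCocentralAction K Γ A} {c' : InvariantCocentralAction K Γ A'}

/-- A homomorphism that respects the gradings and the actions induces a homomorphism of the graded
twistings. -/
theorem GradedTwist.exists_map (φ : A →ₐc[K] A')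
    (hφ : ∀ g, ∀ a ∈ c.component g, φ a ∈ c'.component g)
    (hφ' : ∀ g a, φ (c.action g a) = c'.action g (φ a)) :
    ∃ Φ : c.GradedTwist →ₐc[K] c'.GradedTwist, ∀ a, Φ (j c a) = j c' (φ a) := by
  let l : c.GradedTwist →ₗ[K] c'.GradedTwist :=
    (j c').toLinearMap ∘ₗ (φ : A →ₗ[K] A') ∘ₗ (j c).symm.toLinearMap
  have hl : ∀ a, l (j c a) = j c' (φ a) := fun a => by
    change j c' (φ ((j c).symm (j c a))) = _
    rw [LinearEquiv.symm_apply_apply]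
  let Φ : c.GradedTwist →ₐ[K] c'.GradedTwist := AlgHom.ofLinearMap l
    (by rw [← j_one, hl, map_one, j_one])
    (fun x y => by
      obtain ⟨a, rfl⟩ := (j c).surjective x
      obtain ⟨b, rfl⟩ := (j c).surjective y
      induction a using homogeneous_induction (c := c) with
      | add x y hx hy => simp only [map_add, add_mul, hx, hy]
      | mem g a ha => rw [j_mul g a b ha, hl, hl, hl, j_mul g _ _ (hφ g a ha), map_mul, hφ'])
  refine ⟨BialgHom.ofAlgHom Φ (AlgHom.ext fun x => ?_) (AlgHom.ext fun x => ?_), hl⟩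
  · obtain ⟨a, rfl⟩ := (j c).surjective x
    change Coalgebra.counit (R := K) (l (j c a)) = Coalgebra.counit (R := K) (j c a)
    rw [hl, counit_j, counit_j, CoalgHomClass.counit_comp_apply]
  · obtain ⟨a, rfl⟩ := (j c).surjective x
    change TensorProduct.map l l (Coalgebra.comul (R := K) (j c a)) =
      Coalgebra.comul (R := K) (l (j c a))
    rw [hl, comul_j, comul_j, ← CoalgHomClass.map_comp_comul_apply φ]
    have h1 : l ∘ₗ (j c).toLinearMap = (j c').toLinearMap ∘ₗ (φ : A →ₗ[K] A') := LinearMap.ext hl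
    have h2 : TensorProduct.map l l ∘ₗ TensorProduct.map (j c).toLinearMap (j c).toLinearMap =
        TensorProduct.map (j c').toLinearMap (j c').toLinearMap ∘ₗ
          TensorProduct.map (φ : A →ₗ[K] A') (φ : A →ₗ[K] A') := by
      rw [← TensorProduct.map_comp, ← TensorProduct.map_comp, h1]
    exact LinearMap.congr_fun h2 _

end Functoriality

section Image
variable {K Γ A L : Type*} [Field K] [CommGroup Γ] [Ring A] [HopfAlgebra K A] [Ring L]
  [HopfAlgebra K L] {c : InvariantCocentralAction K Γ A} (f : c.GradedTwist →ₐc[K] L)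

/-- The map `a ↦ f (j a)`. -/
noncomputable def comap : A →ₗc[K] L where
  toLinearMap := (f : c.GradedTwist →ₗ[K] L) ∘ₗ (j c).toLinearMap
  counit_comp := LinearMap.ext fun a =>
    (CoalgHomClass.counit_comp_apply f (j c a)).trans (counit_j a)
  map_comp_comul := LinearMap.ext fun a => by
    rw [TensorProduct.map_comp, LinearMap.comp_apply, LinearMap.comp_apply, ← comul_j]
    exact CoalgHomClass.map_comp_comul_apply f (j c a)

@[simp] theorem comap_apply (a : A) : comap f a = f (j c a) := rfl

/-- The image in `L` of the component of degree `g`. -/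
noncomputable def image (g : Γ) : Submodule K L := (c.component g).map (comap f : A →ₗ[K] L)

variable {f}

theorem mul_mem_image {g h : Γ} {x y : L} (hx : x ∈ image f g) (hy : y ∈ image f h) :
    x * y ∈ image f (g * h) := by
  obtain ⟨a, ha, rfl⟩ := hx
  obtain ⟨b, hb, rfl⟩ := hy
  exact ⟨a * c.action g b, c.mul_mem _ _ _ ha _ (c.action_mem _ _ _ hb), by
    rw [CoalgHom.coe_toLinearMap, comap_apply, ← j_mul g a b ha, map_mul]; rfl⟩

theorem one_mem_image : (1 : L) ∈ image f 1 :=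
  ⟨1, c.one_mem, (congrArg f j_one).trans (map_one f)⟩

theorem antipode_mem_image {g : Γ} {x : L} (hx : x ∈ image f g) :
    HopfAlgebra.antipode K x ∈ image f g⁻¹ := by
  obtain ⟨a, ha, rfl⟩ := hx
  refine ⟨c.action g⁻¹ (HopfAlgebra.antipode K a), c.action_mem _ _ _ (c.antipode_mem _ _ ha), ?_⟩
  exact (congrArg f (antipodeHom_j g a ha).symm).trans (f.map_antipode (j c a))

theorem isSubcoalgebra_image (g : Γ) : (image f g).IsSubcoalgebra := by
  rintro _ ⟨a, ha, rfl⟩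
  obtain ⟨t, ht⟩ := c.comul_mem g a ha
  refine ⟨TensorProduct.map ((comap f : A →ₗ[K] L).restrict (q := image f g) fun a ha => ⟨a, ha, rfl⟩)
    ((comap f : A →ₗ[K] L).restrict (q := image f g) fun a ha => ⟨a, ha, rfl⟩) t, ?_⟩
  have h := CoalgHomClass.map_comp_comul_apply (comap f) a
  refine Eq.trans ?_ h
  rw [← ht, TensorProduct.mapIncl, ← LinearMap.comp_apply, ← LinearMap.comp_apply,
    ← TensorProduct.map_comp, ← TensorProduct.map_comp]
  rfl

/-- For `Γ` of prime order, the images of the components are independent, or the image of the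
component of degree `1` is everything. -/
theorem iSupIndep_image_or [Finite Γ] (hΓ : (Nat.card Γ).Prime) (hf : Function.Surjective f) :
    iSupIndep (image f) ∨ image f 1 = ⊤ := by
  classical
  have := Fintype.ofFinite Γ
  refine or_iff_not_imp_left.2 fun hind => ?_
  rw [iSupIndep] at hind
  push Not at hind
  obtain ⟨g, hg⟩ := hind
  have h1 := (isSubcoalgebra_image g).one_mem_mul_antipode
    (.iSup fun h => .iSup fun _ => isSubcoalgebra_image h) hg
  -- A product of `image f g` with the antipode of `image f h` has degree `g h⁻¹`, which is not `1`
  -- when `h ≠ g`.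
  have h2 : (1 : L) ∈ ⨆ k ∈ Finset.univ.erase (1 : Γ), image f k := by
    refine Submodule.mul_le.2 (fun v hv w hw => ?_) h1
    obtain ⟨x, hx, rfl⟩ := hw
    have h3 : (⨆ h, ⨆ (_ : h ≠ g), image f h) ≤ (⨆ k ∈ Finset.univ.erase (1 : Γ), image f k).comap
        (LinearMap.mulLeft K v ∘ₗ HopfAlgebra.antipode K) := by
      refine iSup₂_le fun h hh x hx => ?_
      exact Submodule.mem_iSup_of_mem (g * h⁻¹) (Submodule.mem_iSup_of_mem
        (Finset.mem_erase.2 ⟨fun h' => hh (mul_inv_eq_one.1 h').symm, Finset.mem_univ _⟩)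
        (mul_mem_image hv (antipode_mem_image hx)))
    exact h3 hx
  obtain ⟨k, hk, h3⟩ := Submodule.IsSubcoalgebra.exists_one_mem _ isSubcoalgebra_image h2
  have hk1 : k ≠ 1 := (Finset.mem_erase.1 hk).1
  -- The degrees whose image contains `1` are closed under products, and `k ≠ 1` generates a group
  -- of prime order.
  have h4 : ∀ n : ℕ, (1 : L) ∈ image f (k ^ n) := by
    intro n
    induction n with
    | zero => rw [pow_zero]; exact one_mem_image
    | succ n ih => rw [pow_succ, ← mul_one (1 : L)]; exact mul_mem_image ih h3
  have h5 : ∀ h : Γ, (1 : L) ∈ image f h := by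
    intro h
    have : Fact (Nat.card Γ).Prime := ⟨hΓ⟩
    obtain ⟨n, rfl⟩ := mem_powers_of_prime_card (p := Nat.card Γ) rfl hk1 (g' := h)
    exact h4 n
  rw [eq_top_iff]
  intro x _
  obtain ⟨y, rfl⟩ := hf x
  obtain ⟨a, rfl⟩ := (j c).surjective y
  induction a using homogeneous_induction (c := c) with
  | add x y hx hy => rw [map_add, map_add]; exact add_mem (hx trivial) (hy trivial)
  | mem h a ha =>
    -- Multiplying by `1`, viewed in degree `h⁻¹`, moves an element of degree `h` to degree `1`.
    rw [← mul_one (f _), ← mul_inv_cancel h]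
    exact mul_mem_image ⟨a, ha, rfl⟩ (h5 _)

end Image
end InvariantCocentralAction

/-! ### Morphisms of groups and Hopf algebra quotients of `𝒪(G)`. -/

namespace CoordRing
variable {K G G' : Type*} [Field K] [Group G] [AffineAlgebraicGroup K G] [Group G']
  [AffineAlgebraicGroup K G']

/-- The homomorphism `𝒪(G) → 𝒪(G')` induced by a morphism `G' → G`. -/
noncomputable def pullback (φ : G' →* G) (h : ∀ f : CoordRing K G,
    (fun x => f (φ x)) ∈ AffineAlgebraicGroup.regular (K := K) (G := G')) :
    CoordRing K G →ₐc[K] CoordRing K G' :=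
  BialgHom.ofAlgHom
    { toFun := fun f => mk K (fun x => f (φ x)) (h f)
      map_one' := rfl
      map_mul' := fun _ _ => rfl
      map_zero' := rfl
      map_add' := fun _ _ => rfl
      commutes' := fun _ => rfl }
    (AlgHom.ext fun f => congrArg f (map_one φ))
    (AlgHom.ext fun f => ext_eval₂ fun x y => by
      have key : ∀ (ψ : CoordRing K G →ₐ[K] CoordRing K G') (_ : ∀ f x, ψ f x = f (φ x))
          (t : CoordRing K G ⊗[K] CoordRing K G),
          eval₂ K x y (Algebra.TensorProduct.map ψ ψ t) = eval₂ K (φ x) (φ y) t := by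
        intro ψ hψ t
        induction t with
        | zero => simp
        | add s t hs ht => simp only [map_add, hs, ht]
        | tmul a b => simp [hψ]
      refine (key _ (fun f x => rfl) (comulHom f)).trans ?_
      refine Eq.trans ?_ (eval₂_comulHom _ x y).symm
      rw [eval₂_comulHom, ← map_mul]
      rfl)

/-- Restriction of regular functions to an algebraic subgroup. -/
noncomputable def restrict (H : AlgebraicSubgroup K G) :
    CoordRing K G →ₐc[K] CoordRing K H.toSubgroup :=
  pullback H.toSubgroup.subtype fun f => ⟨f, f.2, rfl⟩

theorem restrict_surjective (H : AlgebraicSubgroup K G) : Function.Surjective (restrict H) := by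
  rintro ⟨_, f, hf, rfl⟩
  exact ⟨⟨f, hf⟩, rfl⟩

theorem restrict_eq_zero_iff (H : AlgebraicSubgroup K G) (f : CoordRing K G) :
    restrict H f = 0 ↔ ∀ x ∈ H.toSubgroup, f x = 0 :=
  ⟨fun h x hx => congrArg (fun u : CoordRing K H.toSubgroup => u ⟨x, hx⟩) h,
    fun h => ext_eval fun x => h x.1 x.2⟩

/-- Hopf algebra quotients of `𝒪(G)` are the algebras `𝒪(H)` for algebraic subgroups `H`. -/
theorem exists_subgroup_of_surjective [IsAlgClosed K] [CharZero K] {L : Type*} [Ring L]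
    [Bialgebra K L] (q : CoordRing K G →ₐc[K] L) (hq : Function.Surjective q) :
    ∃ H : AlgebraicSubgroup K G, Nonempty (L ≃ₐc[K] CoordRing K H.toSubgroup) := by
  have hJ := isBiideal_of_coalgHom (q : CoordRing K G →ₗc[K] L) hq
    (RingHom.ker (q : CoordRing K G →ₐ[K] L)) fun f => Iff.rfl
  refine ⟨hJ.zeroSubgroup, BialgHom.nonempty_equiv_of_ker_eq q (restrict _) hq
    (restrict_surjective _) fun a => ?_⟩
  rw [restrict_eq_zero_iff]
  exact hJ.mem_iff_vanish a

end CoordRing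

/-! ### When the twist is commutative. -/

namespace GroupCocentralAction
open InvariantCocentralAction InvariantCocentralAction.GradedTwist
variable {K Γ G : Type*} [Field K] [CommGroup Γ] [Group G] [AffineAlgebraicGroup K G]
  (act : GroupCocentralAction K Γ G) [IsAlgClosed K] [CharZero K] [Finite Γ]

/-- Evaluations at the distinct points `i(ψ)` are distinct characters, so by Dedekind they are
linearly independent. Hence `∑ ψ(g)⁻¹ a(i(ψ))` is nonzero for some `a`; up to the factor `|Γ|` it is
the value at `1` of the degree `g` part of `a`. -/
theorem exists_mem_component_one (g : Γ) : ∃ a ∈ act.component g, a 1 = 1 := by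
  have := Fintype.ofFinite (Γ →* Kˣ)
  have hli := (linearIndependent_monoidHom (CoordRing K G) K).comp
    (fun ψ : Γ →* Kˣ => ((CoordRing.eval K (act.i ψ) : CoordRing K G →ₐ[K] K) :
      CoordRing K G →* K)) (fun ψ φ h => act.i_injective
        (AffineAlgebraicGroup.separates (K := K) _ _ fun f hf => DFunLike.congr_fun h
          (⟨f, hf⟩ : CoordRing K G)))
  obtain ⟨a, ha⟩ : ∃ a : CoordRing K G, ∑ ψ : Γ →* Kˣ, ((ψ g)⁻¹ : Kˣ) * a (act.i ψ) ≠ 0 := by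
    by_contra! hcon
    have := Fintype.linearIndependent_iff.1 hli (fun ψ => (((ψ g)⁻¹ : Kˣ) : K))
      (funext fun a => by simpa using hcon a) 1
    exact Units.ne_zero _ this
  have h1 : act.proj g a 1 ≠ 0 := by
    rw [proj_apply]
    refine mul_ne_zero (inv_ne_zero (card_ne_zero (K := K) (Γ := Γ))) ?_
    simpa using ha
  exact ⟨(act.proj g a 1)⁻¹ • act.proj g a, Submodule.smul_mem _ _ (act.proj_mem g a), by
    rw [CoordRing.smul_apply, inv_mul_cancel₀ h1]⟩

section Commutative

/-- At a fixed `x`, writing `α_g(x) = i(ψ_g) x` defines a homomorphism from `Γ` to its dual, because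
`α` fixes `i(Γ̂)`. The two products of elements of degrees `g` and `k` differ at `x` only by
`ψ_{g⁻¹}(k)` against `ψ_{k⁻¹}(g)`, and a bicharacter of a cyclic group is symmetric. -/
theorem twist_commutative [IsCyclic Γ] (h : ∀ x g, ∃ ψ, act.α g x = act.i ψ * x)
    (u v : act.TwistedCoordRing) : u * v = v * u := by
  obtain ⟨a, rfl⟩ := (j act.toHopf).surjective u
  obtain ⟨b, rfl⟩ := (j act.toHopf).surjective v
  induction a using homogeneous_induction (c := act.toHopf) with
  | add x y hx hy => simp only [map_add, add_mul, mul_add, hx, hy]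
  | mem g a ha =>
    induction b using homogeneous_induction (c := act.toHopf) with
    | add x y hx hy => simp only [map_add, add_mul, mul_add, hx, hy]
    | mem k b hb =>
      rw [j_mul g a b ha, j_mul k b a hb]
      congr 1
      refine CoordRing.ext_eval fun x => ?_
      change a x * b (act.α g⁻¹ x) = b x * a (act.α k⁻¹ x)
      choose ψ hψ using h x
      have hmul : ∀ g k, ψ (g * k) = ψ g * ψ k := fun g k => act.i_injective (by
        have h1 := hψ (g * k)
        rw [map_mul, MulAut.mul_apply, hψ k, map_mul, act.α_i, hψ g, ← mul_assoc,
          mul_left_inj, ← map_mul] at h1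
        rw [← h1, map_mul, map_mul, act.i_comm])
      let Ψ : Γ →* Γ →* Kˣ := MonoidHom.mk' ψ hmul
      have hsymm : Ψ g k = Ψ k g := by
        obtain ⟨t, ht⟩ := IsCyclic.exists_generator (α := Γ)
        obtain ⟨m, rfl⟩ := Subgroup.mem_zpowers_iff.1 (ht g)
        obtain ⟨n, rfl⟩ := Subgroup.mem_zpowers_iff.1 (ht k)
        simp only [map_zpow, MonoidHom.zpow_apply, ← zpow_mul, mul_comm]
      have hsymm' : (ψ g⁻¹) k = (ψ k⁻¹) g := by
        change Ψ g⁻¹ k = Ψ k⁻¹ g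
        rw [map_inv, map_inv, MonoidHom.inv_apply, MonoidHom.inv_apply, hsymm]
      have ha' : a (act.i (ψ k⁻¹) * x) = _ := ha (ψ k⁻¹) x
      have hb' : b (act.i (ψ g⁻¹) * x) = _ := hb (ψ g⁻¹) x
      rw [hψ, hψ, ha', hb', hsymm']
      ring

/-- An `i(Γ̂)`-invariant function `b` has degree `1`, so commuting it with an element of degree
`g⁻¹` that equals `1` at `x` gives `b(α_g x) = b(x)`. Invariant functions separate the cosets of
`i(Γ̂)`. -/
theorem exists_of_twist_commutative (h : ∀ u v : act.TwistedCoordRing, u * v = v * u) (x : G)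
    (g : Γ) : ∃ ψ, act.α g x = act.i ψ * x := by
  have key : ((act.α g x : G) : G ⧸ act.i.range) = x := by
    refine AffineAlgebraicGroup.quotient_separates (K := K) act.i.range _ _ fun F hF => ?_
    let b : CoordRing K G := CoordRing.mk K (fun x => F x) hF
    have hb : b ∈ act.component 1 := fun ψ y => by
      change F ((act.i ψ * y : G) : G ⧸ act.i.range) = _ * F y
      rw [AffineAlgebraicGroup.eq_mk_mul act.i.range ⟨act.i ψ, ψ, rfl⟩ y]
      simp
    obtain ⟨a, ha, ha1⟩ := act.exists_mem_component_one g⁻¹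
    let a' : CoordRing K G := CoordRing.rightTranslate x⁻¹ a
    have ha' : a' ∈ act.component g⁻¹ := fun ψ y => by
      rw [CoordRing.rightTranslate_apply, CoordRing.rightTranslate_apply, mul_assoc, ha]
    have hx : a' x = 1 := by rw [CoordRing.rightTranslate_apply, mul_inv_cancel, ha1]
    have h1 := h (j act.toHopf a') (j act.toHopf b)
    rw [j_mul g⁻¹ a' b ha', j_mul 1 b a' hb, act.toHopf.action_one] at h1
    have h2 : a' x * b (act.α g⁻¹⁻¹ x) = b x * a' x :=
      congrArg (fun u : CoordRing K G => u x) ((j act.toHopf).injective h1)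
    rw [hx, one_mul, mul_one, inv_inv] at h2
    exact h2
  obtain ⟨ψ, hψ⟩ := QuotientGroup.eq.1 key.symm
  refine ⟨ψ, ?_⟩
  rw [← act.i_comm, hψ, mul_inv_cancel_left]

end Commutative
end GroupCocentralAction

/-! ### Subgroups attached to the quotients of the twist. -/

namespace GroupCocentralAction
open InvariantCocentralAction InvariantCocentralAction.GradedTwist
variable {K Γ G : Type*} [Field K] [CommGroup Γ] [Group G] [AffineAlgebraicGroup K G]
  (act : GroupCocentralAction K Γ G) [IsAlgClosed K] [CharZero K] [Finite Γ]

section Restrict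
variable (H : AlgebraicSubgroup K G) (hi : act.i.range ≤ H.toSubgroup)
  (hα : act.IsStable H.toSubgroup)

theorem twist_restrict_commutative_iff [IsCyclic Γ] :
    (∀ u v : (act.restrict H hi hα).TwistedCoordRing, u * v = v * u) ↔
      act.stabilizedSubset H.toSubgroup = H.toSubgroup := by
  constructor
  · intro h
    refine Set.Subset.antisymm (fun x hx => hx.1) fun x hx => ⟨hx, fun g => ?_⟩
    obtain ⟨ψ, hψ⟩ := (act.restrict H hi hα).exists_of_twist_commutative h ⟨x, hx⟩ g
    exact ⟨ψ, congrArg Subtype.val hψ⟩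
  · intro h
    refine (act.restrict H hi hα).twist_commutative fun x g => ?_
    have hx : x.1 ∈ act.stabilizedSubset H.toSubgroup := by rw [h]; exact x.2
    obtain ⟨ψ, hψ⟩ := hx.2 g
    exact ⟨ψ, Subtype.ext hψ⟩

/-- Restriction of functions induces a homomorphism of graded twistings. -/
theorem exists_twist_restrict :
    ∃ Φ : act.TwistedCoordRing →ₐc[K] (act.restrict H hi hα).TwistedCoordRing,
      ∀ a, Φ (j act.toHopf a) = j (act.restrict H hi hα).toHopf (CoordRing.restrict H a) :=
  GradedTwist.exists_map (CoordRing.restrict H) (fun _ _ ha ψ x => ha ψ x.1) fun _ _ => rfl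

end Restrict

section Quotient

/-- The homomorphism `𝒪(G ⧸ i(Γ̂)) → 𝒪(G^{t,α})`. -/
theorem exists_quotient_to_twist :
    ∃ ι : CoordRing K (G ⧸ act.i.range) →ₐc[K] act.TwistedCoordRing,
      ∀ a ∈ act.component 1, ∃ b, ι b = j act.toHopf a := by
  let π : CoordRing K (G ⧸ act.i.range) →ₐc[K] CoordRing K G :=
    CoordRing.pullback (QuotientGroup.mk' act.i.range) fun f => f.2
  have hπ : ∀ b, π b ∈ act.component 1 := fun b ψ y => by
    change b ((act.i ψ * y : G) : G ⧸ act.i.range) = _ * b (y : G ⧸ act.i.range)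
    rw [AffineAlgebraicGroup.eq_mk_mul act.i.range ⟨act.i ψ, ψ, rfl⟩ y]
    simp
  -- Elements of degree `1` multiply in the twist as in `𝒪(G)`, so `j ∘ π` is multiplicative.
  let l : CoordRing K (G ⧸ act.i.range) →ₐ[K] act.TwistedCoordRing :=
    AlgHom.ofLinearMap ((j act.toHopf).toLinearMap ∘ₗ (π : _ →ₗ[K] CoordRing K G))
      ((congrArg _ (map_one π)).trans j_one) fun a b => by
        change j act.toHopf (π (a * b)) = j act.toHopf (π a) * j act.toHopf (π b)
        rw [j_mul 1 _ _ (hπ a), act.toHopf.action_one, map_mul]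
  refine ⟨BialgHom.ofAlgHom l (AlgHom.ext fun x => ?_) (AlgHom.ext fun x => ?_), fun a ha => ?_⟩
  · change Coalgebra.counit (R := K) (j act.toHopf (π x)) = Coalgebra.counit (R := K) x
    rw [counit_j, CoalgHomClass.counit_comp_apply]
  · change TensorProduct.map ((j act.toHopf).toLinearMap ∘ₗ (π : _ →ₗ[K] CoordRing K G))
      ((j act.toHopf).toLinearMap ∘ₗ (π : _ →ₗ[K] CoordRing K G)) (Coalgebra.comul (R := K) x) =
      Coalgebra.comul (R := K) (j act.toHopf (π x))
    rw [comul_j, ← CoalgHomClass.map_comp_comul_apply π, TensorProduct.map_comp]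
    rfl
  · obtain ⟨F, hF, hFa⟩ := AffineAlgebraicGroup.exists_descend act.i.range a a.2 (by
      rintro ⟨_, ψ, rfl⟩ x
      exact (ha ψ x).trans (by simp))
    exact ⟨CoordRing.mk K F hF, congrArg (j act.toHopf) (CoordRing.ext_eval hFa)⟩

variable {act} {L : Type*} [Ring L] [HopfAlgebra K L] {f : act.TwistedCoordRing →ₐc[K] L}

/-- If the images of the components are independent, then the kernel is graded. -/
theorem ker_induction (hind : iSupIndep (image f)) {p : CoordRing K G → Prop}
    (mem : ∀ g, ∀ a ∈ act.component g, f (j act.toHopf a) = 0 → p a) (zero : p 0)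
    (add : ∀ a b, p a → p b → p (a + b)) {a : CoordRing K G} (ha : f (j act.toHopf a) = 0) :
    p a := by
  have := Fintype.ofFinite (Γ →* Kˣ)
  have := Fintype.ofFinite Γ
  rw [← act.sum_proj a]
  refine Finset.sum_induction _ p add zero fun g _ => mem g _ (act.proj_mem g a) ?_
  refine (iSupIndep_iff_finsetSum_eq_zero_imp_eq_zero _).1 hind Finset.univ
    (fun g => f (j act.toHopf (act.proj g a))) (fun g _ => ⟨_, act.proj_mem g a, rfl⟩) ?_ g
    (Finset.mem_univ g)
  rw [← map_sum, ← map_sum, act.sum_proj, ha]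

/-- For `x` of degree `g`, commutativity of `𝒪(G)` gives `j(α_g a) j(x) = j(α_g(a) α_h(x)) = j(α_h
x) j(a)`, which `f` kills. So `f (j (α_g a))` annihilates `image f g` from the left. This image is a
nonzero subcoalgebra, so `1` lies in its product with its antipode, and the annihilating element
vanishes. -/
theorem map_action_eq_zero {h : Γ} (g : Γ) {a : CoordRing K G} (ha : a ∈ act.component h)
    (h0 : f (j act.toHopf a) = 0) : f (j act.toHopf (act.hopfAction g a)) = 0 := by
  have h1 : ∀ v ∈ image f g, f (j act.toHopf (act.hopfAction g a)) * v = 0 := by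
    rintro _ ⟨x, hx, rfl⟩
    have h2 := j_mul h (act.hopfAction g a) x (act.toHopf.action_mem g h a ha)
    have h3 := j_mul g (act.hopfAction h x) a (act.toHopf.action_mem h g x hx)
    have h4 : act.hopfAction g a * act.toHopf.action h x =
        act.hopfAction h x * act.toHopf.action g a := mul_comm _ _
    change f _ * f (j act.toHopf x) = 0
    rw [← map_mul, h2, h4, ← h3, map_mul, h0, mul_zero]
  obtain ⟨e, he, he1⟩ := act.exists_mem_component_one g
  have hne : ¬ Disjoint (image f g) (image f g) := by
    rw [disjoint_self]
    intro hbot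
    have hz : f (j act.toHopf e) ∈ image f g := ⟨e, he, rfl⟩
    rw [hbot, Submodule.mem_bot] at hz
    have h2 := CoalgHomClass.counit_comp_apply (comap f) e
    rw [comap_apply, hz, map_zero] at h2
    exact zero_ne_one (h2.trans he1)
  have h2 := (isSubcoalgebra_image g).one_mem_mul_antipode (isSubcoalgebra_image (f := f) g) hne
  rw [← mul_one (f _)]
  refine Submodule.mul_induction_on h2 (fun m hm n _ => ?_) fun x y hx hy => ?_
  · rw [← mul_assoc, h1 m hm, zero_mul]
  · rw [mul_add, hx, hy, add_zero]

theorem map_action_eq_zero_of_iSupIndep (hind : iSupIndep (image f)) (g : Γ) {a : CoordRing K G}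
    (h0 : f (j act.toHopf a) = 0) : f (j act.toHopf (act.hopfAction g a)) = 0 :=
  ker_induction (p := fun a => f (j act.toHopf (act.hopfAction g a)) = 0) hind
    (fun _ _ ha h0 => map_action_eq_zero g ha h0) (by simp)
    (fun a b ha hb => by simp only [map_add, ha, hb, add_zero]) h0

/-- The kernel of `f`, as an ideal of `𝒪(G)`. -/
noncomputable def twistKer (hind : iSupIndep (image f)) : Ideal (CoordRing K G) where
  carrier := {a | f (j act.toHopf a) = 0}
  add_mem' {a b} ha hb := by
    change f (j act.toHopf (a + b)) = 0
    rw [map_add, map_add, ha, hb, add_zero]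
  zero_mem' := by
    change f (j act.toHopf 0) = 0
    rw [map_zero, map_zero]
  smul_mem' r a ha := by
    change f (j act.toHopf (r * a)) = 0
    induction r using homogeneous_induction (c := act.toHopf) with
    | add x y hx hy => rw [add_mul, map_add, map_add, hx, hy, add_zero]
    | mem g r hr =>
      -- For `r` of degree `g`, `j(r a) = j(r) j(α_{g⁻¹} a)`, so `Γ`-stability of the kernel absorbs
      -- the twist.
      have h1 := map_action_eq_zero_of_iSupIndep hind g⁻¹ ha
      have h2 : act.toHopf.action g (act.hopfAction g⁻¹ a) = a := by
        change act.toHopf.action g (act.toHopf.action g⁻¹ a) = a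
        rw [← act.toHopf.action_mul, mul_inv_cancel, act.toHopf.action_one]
      have h3 := j_mul g r (act.hopfAction g⁻¹ a) hr
      rw [h2] at h3
      rw [← h3, map_mul, h1, mul_zero]

/-- `H` is the zero set of `twistKer`. It contains `i(Γ̂)` because a homogeneous `a` of degree `g`
in the kernel satisfies `a(i(ψ)) = ψ(g) a(1) = 0`, and such elements span the kernel. By Cartier's
theorem `f` and the twisted restriction to `H` then have the same kernel. -/
theorem exists_subgroup_of_iSupIndep (hf : Function.Surjective f) (hind : iSupIndep (image f)) :
    ∃ (H : AlgebraicSubgroup K G) (hα : act.IsStable H.toSubgroup)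
      (hi : act.i.range ≤ H.toSubgroup),
      Nonempty (L ≃ₐc[K] (act.restrict H hi hα).TwistedCoordRing) := by
  have hJ := CoordRing.isBiideal_of_coalgHom (comap f) (hf.comp (j act.toHopf).surjective)
    (twistKer hind) fun _ => Iff.rfl
  have hα : act.IsStable hJ.zeroSubgroup.toSubgroup := fun g x hx a ha => by
    have h1 : act.hopfAction g⁻¹ a x = 0 := hx _ (map_action_eq_zero_of_iSupIndep hind g⁻¹ ha)
    rwa [hopfAction_apply, inv_inv] at h1
  have hi : act.i.range ≤ hJ.zeroSubgroup.toSubgroup := by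
    rintro _ ⟨ψ, rfl⟩ a ha
    refine ker_induction (p := fun a => a (act.i ψ) = 0) hind (fun g a hag ha => ?_) (by simp)
      (fun a b ha hb => by rw [CoordRing.add_apply, ha, hb, add_zero]) ha
    have h1 := hag ψ 1
    rwa [mul_one, hJ.eval_one a ha, mul_zero] at h1
  refine ⟨hJ.zeroSubgroup, hα, hi, ?_⟩
  obtain ⟨Φ, hΦ⟩ := act.exists_twist_restrict hJ.zeroSubgroup hi hα
  refine BialgHom.nonempty_equiv_of_ker_eq f Φ hf (fun y => ?_) fun u => ?_
  · obtain ⟨b, rfl⟩ := (j _).surjective y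
    obtain ⟨a, rfl⟩ := CoordRing.restrict_surjective _ b
    exact ⟨_, hΦ a⟩
  · obtain ⟨a, rfl⟩ := (j act.toHopf).surjective u
    rw [hΦ, LinearEquiv.map_eq_zero_iff, CoordRing.restrict_eq_zero_iff]
    exact hJ.mem_iff_vanish a

/-- The degree `1` part of the twist is the image of the commutative algebra `𝒪(G/i(Γ̂))`, which
therefore already surjects onto `L`. -/
theorem exists_subgroup_quotient_of_image_one (h : image f 1 = ⊤) :
    (∀ a b : L, a * b = b * a) ∧ ∃ H : AlgebraicSubgroup K (G ⧸ act.i.range),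
      Nonempty (L ≃ₐc[K] CoordRing K H.toSubgroup) := by
  obtain ⟨ι, hι⟩ := act.exists_quotient_to_twist
  have hq : Function.Surjective (f.comp ι) := fun x => by
    have hx : x ∈ image f 1 := by rw [h]; trivial
    obtain ⟨a, ha, rfl⟩ := hx
    obtain ⟨b, hb⟩ := hι a ha
    exact ⟨b, congrArg f hb⟩
  refine ⟨fun a b => ?_, CoordRing.exists_subgroup_of_surjective _ hq⟩
  obtain ⟨a, rfl⟩ := hq a
  obtain ⟨b, rfl⟩ := hq b
  rw [← map_mul, mul_comm, map_mul]

end Quotient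
end GroupCocentralAction

theorem mainTheorem6 {K Γ G L : Type*} [Field K] [IsAlgClosed K] [CharZero K]
    [CommGroup Γ] [IsCyclic Γ] [Finite Γ] (hΓ : (Nat.card Γ).Prime)
    [Group G] [AffineAlgebraicGroup K G] (act : GroupCocentralAction K Γ G)
    [Ring L] [HopfAlgebra K L] (f : act.TwistedCoordRing →ₐc[K] L) (hf : Function.Surjective f) :
    ((∀ a b : L, a * b = b * a) ∧
      ∃ H : AlgebraicSubgroup K (G ⧸ act.i.range),
        Nonempty (L ≃ₐc[K] CoordRing K H.toSubgroup)) ∨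
    ((∀ a b : L, a * b = b * a) ∧
      ∃ (H : AlgebraicSubgroup K G) (hα : act.IsStable H.toSubgroup)
        (hi : act.i.range ≤ H.toSubgroup),
        act.stabilizedSubset H.toSubgroup = H.toSubgroup ∧
        Nonempty (L ≃ₐc[K] (act.restrict H hi hα).TwistedCoordRing)) ∨
    ((¬ ∀ a b : L, a * b = b * a) ∧
      ∃ (H : AlgebraicSubgroup K G) (hα : act.IsStable H.toSubgroup)
        (hi : act.i.range ≤ H.toSubgroup),
        act.stabilizedSubset H.toSubgroup ≠ H.toSubgroup ∧
        Nonempty (L ≃ₐc[K] (act.restrict H hi hα).TwistedCoordRing)) := by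
  rcases InvariantCocentralAction.iSupIndep_image_or hΓ hf with hind | hone
  · right
    obtain ⟨H, hα, hi, ⟨e⟩⟩ := GroupCocentralAction.exists_subgroup_of_iSupIndep hf hind
    have hiff := act.twist_restrict_commutative_iff H hi hα
    by_cases hL : ∀ a b : L, a * b = b * a
    · refine .inl ⟨hL, H, hα, hi, hiff.1 fun u v => ?_, ⟨e⟩⟩
      exact e.symm.injective (by rw [map_mul, map_mul, hL])
    · refine .inr ⟨hL, H, hα, hi, fun h => hL fun a b => ?_, ⟨e⟩⟩
      exact e.injective (by rw [map_mul, map_mul, hiff.2 h])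
  · exact .inl (GroupCocentralAction.exists_subgroup_quotient_of_image_one hone)
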